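/- Let $N\ge 1$ be an integer, $1<p<\infty$ and $\gamma\in\mathbb R$. For a measurable set $E\subset\mathbb R^N\times\mathbb R^N$ put $$\nu_\gamma(E)=\iint_{(x,y)\in E,\ x\ne y}|x-y|^{\gamma-N}\,dx\,dy .$$ For a measurable $u:\mathbb R^N\to\mathbb R$, $b\in\mathbb R$ and $x\neq y$ put $Q_bu(x,y)=\dfrac{u(x)-u(y)}{|x-y|^{1+b}}$, and for a measurable function $F$ on $\mathbb R^N\times\mathbb R^N$ put $$[F]_{L^{p,\infty}(\nu_\gamma)}=\sup_{\lambda>0}\lambda\,\nu_\gamma\big(\{|F|>\lambda\}\big)^{1/p}\in[0,\infty];$$ $F\in L^{p,\infty}(\nu_\gamma)$ means that this quantity is finite. Let $\dot W^{1,p}(\mathbb R^N)$ be the space of all $u\in L^1_{\mathrm{loc}}(\mathbb R^N)$ whose distributional gradient $\nabla u$ belongs to $L^p(\mathbb R^N)$. Then the following hold. (i) There is a constant $C=C(N,p,\gamma)<\infty$ such that $$[Q_{\gamma/p}u]_{L^{p,\infty}(\nu_\gamma)}\le C\,\|\nabla u\|_{L^p(\mathbb R^N)}$$ for all $u\in C_c^\infty(\mathbb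 R^N)$ if and only if $\gamma\ne0$. If $\gamma\neq 0$, then this inequality, with a constant $C$ depending only on $N,p,\gamma$, extends to all $u\in\dot W^{1,p}(\mathbb R^N)$. (ii) There is a constant $C=C(N,p,\gamma)<\infty$ (for every real $\gamma$, including $\gamma=0$) such that, whenever $u\in L^1_{\mathrm{loc}}(\mathbb R^N)$ and $Q_{\gamma/p}u\in L^{p,\infty}(\nu_\gamma)$, one has $u\in\dot W^{1,p}(\mathbb R^N)$ and $$\|\nabla u\|_{L^p(\mathbb R^N)}\le C\,[Q_{\gamma/p}u]_{L^{p,\infty}(\nu_\gamma)} .$$ -/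

import Mathlib

open MeasureTheory
open scoped ENNReal NNReal ContDiff

noncomputable section

/-- The measure `dν_γ(x,y) = |x - y|^(γ - N) dx dy` on `{(x, y) ∈ ℝ^N × ℝ^N : x ≠ y}`. -/
def nuMeasure (N : ℕ) (γ : ℝ) :
    Measure (EuclideanSpace ℝ (Fin N) × EuclideanSpace ℝ (Fin N)) :=
  (volume.restrict {z : EuclideanSpace ℝ (Fin N) × EuclideanSpace ℝ (Fin N) |
    z.1 ≠ z.2}).withDensity (fun z => ENNReal.ofReal (‖z.1 - z.2‖ ^ (γ - (N : ℝ))))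

/-- The difference quotient `Q_b u(x,y) = (u(x) - u(y)) / |x - y|^(1 + b)`.
On the diagonal, which `nuMeasure` does not charge, its value here is `0`. -/
def diffQuot {N : ℕ} (b : ℝ) (u : EuclideanSpace ℝ (Fin N) → ℝ)
    (z : EuclideanSpace ℝ (Fin N) × EuclideanSpace ℝ (Fin N)) : ℝ :=
  (u z.1 - u z.2) / ‖z.1 - z.2‖ ^ (1 + b)

/-- The weak `L^p` quasi-norm `[F]_{L^{p,∞}(μ)} = sup_{t > 0} t μ({|F| > t})^(1/p)`,
with values in `[0, ∞]`. -/
def weakLpNorm {α : Type*} [MeasurableSpace α] (F : α → ℝ) (p : ℝ) (μ : Measure α) : ℝ≥0∞ :=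
  ⨆ (t : ℝ) (_ : 0 < t), ENNReal.ofReal t * μ {z | t < |F z|} ^ (1 / p)

/-- `g` is a locally integrable representative of the distributional gradient of `u`:
`∫ u ∂_i φ = - ∫ g_i φ` for all real test functions `φ ∈ C_c^∞(ℝ^N)` and all `i`. -/
structure HasWeakGradient {N : ℕ} (u : EuclideanSpace ℝ (Fin N) → ℝ)
    (g : EuclideanSpace ℝ (Fin N) → EuclideanSpace ℝ (Fin N)) : Prop where
  locallyIntegrable : LocallyIntegrable g volume
  integral_eq : ∀ φ : EuclideanSpace ℝ (Fin N) → ℝ, ContDiff ℝ ∞ φ → HasCompactSupport φ →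
    ∀ i : Fin N, ∫ x, u x * fderiv ℝ φ x (EuclideanSpace.single i 1) = - ∫ x, g x i * φ x

/-- The homogeneous Sobolev space: locally integrable functions whose distributional
gradient belongs to `L^p`. -/
def MemHomogeneousSobolev {N : ℕ} (p : ℝ) (u : EuclideanSpace ℝ (Fin N) → ℝ) : Prop :=
  LocallyIntegrable u volume ∧
    ∃ g : EuclideanSpace ℝ (Fin N) → EuclideanSpace ℝ (Fin N),
      HasWeakGradient u g ∧ MemLp g (ENNReal.ofReal p) volume

end

set_option linter.unusedSectionVars false

section SobolevDifferenceQuotients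

open Set Filter Topology Metric
open scoped Convolution

noncomputable section

/-! ### Power integrals on the half-line -/

/-! Put `y = x + r h` with `1 < ‖h‖ < 2`. Up to a finite positive factor, `ν_γ` becomes `r^(γ-1) dr
dx dh` (`annulusConst_mul_nuMeasure`), so superlevel sets can be measured ray by ray. The decisive
computation is that `r^(γ-1) dr` gives `{r^(γ/p) < b}` the mass `b^p / |γ|`, for either sign of `γ`
(`lintegral_rpow_sub_one_indicator`).

Upper bound for `C¹` functions. Along a ray, `|v(x + r h) - v(x)| ≤ 4 r M(x)`, where `M` is a
one-sided maximal function of `|∇v|` in direction `h`. Hence `|Q v| > t` forces `r^(γ/p) < D M(x) /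
t`, which has mass `(D M(x) / t)^p / |γ|`. The `L^p` bound for `M`, uniform in `h`, finishes the
estimate (`exists_weakLpNorm_diffQuot_le`).

Lower bound for `C¹` functions. For small `r` the increment is at least `|∂_h v(x)| r / 2`. Sending
the level to infinity for `γ > 0` and to zero for `γ ≤ 0` makes only small `r` matter, and Fatou's
lemma bounds the quasi-norm below by `‖∇v‖_p`. For `γ = 0` the mass near `r = 0` diverges, so the
constant is infinite (`exists_lintegral_fderiv_le_weakLpNorm`); this is why the bound in (i) fails
there.

General functions are reached by mollification. Gradients of mollifications are mollified gradients,
so the upper bound passes to the limit. For the converse, a mollified difference quotient is an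
average of diagonal translates of the original, and such averages are bounded in weak `L^p` because
`p > 1` (`exists_weakLpNorm_diffQuot_mollify_le`). The mollified gradients are then bounded in
`L^p`, and a limit is extracted by convex combinations converging almost everywhere
(`exists_convexCombination_ae_tendsto`), obtained by minimizing the strictly convex functional `∫
√(1 + |h|²)`; this limit is the weak gradient. -/

theorem lintegral_Ioo_zero_rpow_sub_one {γ R : ℝ} (hγ : 0 < γ) (hR : 0 ≤ R) :
    ∫⁻ r in Ioo 0 R, ENNReal.ofReal (r ^ (γ - 1)) = ENNReal.ofReal (R ^ γ / γ) := by
  have hi : IntervalIntegrable (fun r : ℝ => r ^ (γ - 1)) volume 0 R :=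
    intervalIntegral.intervalIntegrable_rpow' (by linarith)
  rw [← ofReal_integral_eq_lintegral_ofReal]
  · rw [← integral_Ioc_eq_integral_Ioo, ← intervalIntegral.integral_of_le hR,
      integral_rpow (Or.inl (by linarith))]
    rw [sub_add_cancel, Real.zero_rpow hγ.ne', sub_zero]
  · exact ((intervalIntegrable_iff_integrableOn_Ioo_of_le hR).1 hi)
  · exact (ae_restrict_iff' measurableSet_Ioo).2
      (Eventually.of_forall fun r hr => Real.rpow_nonneg hr.1.le _)

theorem lintegral_Ioi_rpow_sub_one {γ R : ℝ} (hγ : γ < 0) (hR : 0 < R) :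
    ∫⁻ r in Ioi R, ENNReal.ofReal (r ^ (γ - 1)) = ENNReal.ofReal (R ^ γ / |γ|) := by
  rw [← ofReal_integral_eq_lintegral_ofReal]
  · rw [integral_Ioi_rpow_of_lt (by linarith) hR, sub_add_cancel, abs_of_neg hγ, div_neg, neg_div]
  · exact integrableOn_Ioi_rpow_of_lt (by linarith) hR
  · exact (ae_restrict_iff' measurableSet_Ioi).2
      (Eventually.of_forall fun r hr => Real.rpow_nonneg (hR.le.trans (le_of_lt hr)) _)

theorem lintegral_Ioo_zero_inv {R : ℝ} (hR : 0 < R) :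
    ∫⁻ r in Ioo 0 R, ENNReal.ofReal (r ^ (-1 : ℝ)) = ⊤ := by
  by_contra h
  have : IntegrableOn (fun r : ℝ => r ^ (-1 : ℝ)) (Ioo 0 R) := by
    refine ⟨(measurable_id.pow_const _).aestronglyMeasurable, ?_⟩
    rw [hasFiniteIntegral_iff_ofReal]
    · exact lt_top_iff_ne_top.2 h
    · exact (ae_restrict_iff' measurableSet_Ioo).2
        (Eventually.of_forall fun r hr => Real.rpow_nonneg hr.1.le _)
  rw [intervalIntegral.integrableOn_Ioo_rpow_iff hR] at this
  exact lt_irrefl _ this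

/-- The set is a half-line or an interval with endpoint `R = b ^ (p / γ)`: above `R` for `γ < 0`,
between `0` and `R` for `γ > 0`. It always lies on the side where `r ^ (γ - 1)` is integrable, and
`R ^ γ = b ^ p`. -/
theorem lintegral_rpow_sub_one_indicator_of_lt_top {p γ : ℝ} (hp : 0 < p) (hγ : γ ≠ 0)
    {b : ℝ} (hb : 0 < b) :
    ∫⁻ r in Ioi (0 : ℝ), {r : ℝ | r ^ (γ / p) < b}.indicator
      (fun r => ENNReal.ofReal (r ^ (γ - 1))) r = ENNReal.ofReal (b ^ p / |γ|) := by
  have hms : MeasurableSet {r : ℝ | r ^ (γ / p) < b} :=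
    measurableSet_lt (measurable_id.pow_const _) measurable_const
  rw [lintegral_indicator hms, Measure.restrict_restrict hms]
  have hR : 0 < b ^ (p / γ) := Real.rpow_pos_of_pos hb _
  have hbR : (b ^ (p / γ)) ^ (γ / p) = b := by
    rw [← Real.rpow_mul hb.le]
    rw [show p / γ * (γ / p) = 1 by field_simp, Real.rpow_one]
  have hbγ : (b ^ (p / γ)) ^ γ = b ^ p := by
    rw [← Real.rpow_mul hb.le]
    rw [show p / γ * γ = p by field_simp]
  rcases lt_or_gt_of_ne hγ with hneg | hpos
  · have : {r : ℝ | r ^ (γ / p) < b} ∩ Ioi 0 = Ioi (b ^ (p / γ)) := by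
      ext r
      simp only [mem_inter_iff, mem_ofPred_eq, mem_Ioi]
      constructor
      · rintro ⟨h1, h2⟩
        rw [← hbR] at h1
        exact (Real.rpow_lt_rpow_iff_of_neg h2 hR (div_neg_of_neg_of_pos hneg hp)).1 h1
      · intro h
        have h2 : 0 < r := hR.trans h
        refine ⟨?_, h2⟩
        rw [← hbR]
        exact (Real.rpow_lt_rpow_iff_of_neg h2 hR (div_neg_of_neg_of_pos hneg hp)).2 h
    rw [this, lintegral_Ioi_rpow_sub_one hneg hR, hbγ]
  · have : {r : ℝ | r ^ (γ / p) < b} ∩ Ioi 0 = Ioo 0 (b ^ (p / γ)) := by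
      ext r
      simp only [mem_inter_iff, mem_ofPred_eq, mem_Ioi, mem_Ioo]
      constructor
      · rintro ⟨h1, h2⟩
        rw [← hbR] at h1
        exact ⟨h2, (Real.rpow_lt_rpow_iff h2.le hR.le (div_pos hpos hp)).1 h1⟩
      · rintro ⟨h2, h⟩
        refine ⟨?_, h2⟩
        rw [← hbR]
        exact (Real.rpow_lt_rpow_iff h2.le hR.le (div_pos hpos hp)).2 h
    rw [this, lintegral_Ioo_zero_rpow_sub_one hpos hR.le, hbγ, abs_of_pos hpos]

/-- `∫_{r > 0, r^(γ/p) < b} r^(γ - 1) dr = b^p / |γ|`. -/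
theorem lintegral_rpow_sub_one_indicator {p γ : ℝ} (hp : 0 < p) (hγ : γ ≠ 0) (b : ℝ≥0∞) :
    ∫⁻ r in Ioi (0 : ℝ), {r : ℝ | ENNReal.ofReal (r ^ (γ / p)) < b}.indicator
      (fun r => ENNReal.ofReal (r ^ (γ - 1))) r = b ^ p * ENNReal.ofReal |γ|⁻¹ := by
  have hfin : ∀ b : ℝ, 0 < b → ∫⁻ r in Ioi (0 : ℝ),
      {r : ℝ | ENNReal.ofReal (r ^ (γ / p)) < ENNReal.ofReal b}.indicator
      (fun r => ENNReal.ofReal (r ^ (γ - 1))) r =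
        ENNReal.ofReal b ^ p * ENNReal.ofReal |γ|⁻¹ := by
    intro b hb
    rw [ENNReal.ofReal_rpow_of_pos hb, ← ENNReal.ofReal_mul (Real.rpow_nonneg hb.le _),
      ← div_eq_mul_inv, ← lintegral_rpow_sub_one_indicator_of_lt_top hp hγ hb]
    simp only [ENNReal.ofReal_lt_ofReal_iff hb]
  rcases eq_or_ne b 0 with rfl | hb0
  · simp [hp]
  rcases eq_or_ne b ⊤ with rfl | hbt
  · have hγ' : ENNReal.ofReal |γ|⁻¹ ≠ 0 := by simpa using hγ
    rw [ENNReal.top_rpow_of_pos hp, ENNReal.top_mul hγ']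
    rw [eq_top_iff]
    -- The infinite threshold exceeds every finite threshold `n + 1`, whose integrals are known and
    -- tend to infinity.
    have ht : Tendsto (fun n : ℕ => ENNReal.ofReal ((n : ℝ) + 1) ^ p * ENNReal.ofReal |γ|⁻¹)
        atTop (𝓝 ⊤) := by
      have h1 : Tendsto (fun n : ℕ => ENNReal.ofReal ((n : ℝ) + 1)) atTop (𝓝 ⊤) :=
        ENNReal.tendsto_ofReal_nhds_top.2
          (tendsto_atTop_add_const_right _ _ tendsto_natCast_atTop_atTop)
      have h2 := (ENNReal.continuous_rpow_const (y := p)).tendsto ⊤ |>.comp h1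
      rw [ENNReal.top_rpow_of_pos hp] at h2
      have := ENNReal.Tendsto.mul_const (b := ENNReal.ofReal |γ|⁻¹) h2 (Or.inl ENNReal.top_ne_zero)
      rwa [ENNReal.top_mul hγ'] at this
    refine le_of_tendsto' ht fun n => ?_
    rw [← hfin _ (by positivity)]
    refine lintegral_mono fun r => ?_
    refine indicator_le_indicator_of_subset ?_ ?_ r
    · exact fun r hr => lt_top_of_lt (mem_ofPred_eq ▸ hr)
    · exact fun r => zero_le
  · lift b to ℝ≥0 using hbt
    have := hfin b (by simpa [pos_iff_ne_zero] using hb0)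
    simpa using this

/-! ### Integration in dilated annuli -/

section Haar

variable {E : Type*} [NormedAddCommGroup E] [NormedSpace ℝ E] [MeasurableSpace E] [BorelSpace E]
  [FiniteDimensional ℝ E] (μ : Measure E) [μ.IsAddHaarMeasure]

theorem lintegral_comp_const_smul (f : E → ℝ≥0∞) {r : ℝ} (hr : r ≠ 0) :
    ∫⁻ x, f (r • x) ∂μ = ENNReal.ofReal |(r ^ Module.finrank ℝ E)⁻¹| * ∫⁻ x, f x ∂μ := by
  have h := Measure.map_addHaar_smul μ hr
  rw [← smul_eq_mul, ← lintegral_smul_measure, ← h]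
  exact (lintegral_map_equiv f (Homeomorph.smulOfNeZero r hr).toMeasurableEquiv).symm

/-- The open annulus `1 < ‖h‖ < 2`. -/
def unitAnnulus (E : Type*) [NormedAddCommGroup E] : Set E := {h | 1 < ‖h‖ ∧ ‖h‖ < 2}

theorem isOpen_unitAnnulus : IsOpen (unitAnnulus E) :=
  (isOpen_lt continuous_const continuous_norm).inter (isOpen_lt continuous_norm continuous_const)

theorem measurableSet_unitAnnulus : MeasurableSet (unitAnnulus E) :=
  isOpen_unitAnnulus.measurableSet

theorem measure_unitAnnulus_lt_top : μ (unitAnnulus E) < ⊤ :=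
  (measure_mono fun _ h => mem_ball_zero_iff.2 h.2).trans_lt (measure_ball_lt_top (x := 0) (r := 2))

/-- The normalizing constant `∫_{1/2}^1 r^(β - 1) dr`. -/
def annulusConst (β : ℝ) : ℝ≥0∞ := ∫⁻ r in Ioo (1 / 2 : ℝ) 1, ENNReal.ofReal (r ^ (β - 1))

theorem annulusConst_ne_zero (β : ℝ) : annulusConst β ≠ 0 := by
  intro h
  rw [annulusConst, lintegral_eq_zero_iff (by fun_prop)] at h
  have h2 : ∀ᵐ r ∂(volume.restrict (Ioo (1 / 2 : ℝ) 1)), False := by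
    filter_upwards [h, ae_restrict_mem measurableSet_Ioo] with r hr hm
    have : 0 < r ^ (β - 1) := Real.rpow_pos_of_pos (by linarith [hm.1]) _
    simp at hr
    linarith
  have h3 : volume.restrict (Ioo (1 / 2 : ℝ) 1) univ = 0 := by
    simpa only [ae_iff, not_false_eq_true, ofPred_true] using h2
  norm_num at h3

theorem annulusConst_ne_top (β : ℝ) : annulusConst β ≠ ⊤ := by
  have : IntegrableOn (fun r : ℝ => r ^ (β - 1)) (Ioo (1 / 2 : ℝ) 1) := by
    refine IntegrableOn.mono_set (t := Icc (1 / 2 : ℝ) 1) ?_ Ioo_subset_Icc_self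
    refine ContinuousOn.integrableOn_Icc fun r hr => ?_
    exact (Real.continuousAt_rpow_const _ _ (Or.inl (by linarith [hr.1]))).continuousWithinAt
  exact (this.lintegral_lt_top).ne

/-- For `a > 0` the condition is `a / 2 < r < a`; substituting `r = a s` extracts `a ^ β` and leaves
the normalizing constant. Here `a` plays the role of `‖h‖`. -/
theorem lintegral_annulus_slice (β : ℝ) {a : ℝ} (ha : 0 ≤ a) :
    ∫⁻ r in Ioi (0 : ℝ), {r : ℝ | 1 < r⁻¹ * a ∧ r⁻¹ * a < 2}.indicator
      (fun r => ENNReal.ofReal (r ^ (β - 1))) r =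
    if a = 0 then 0 else ENNReal.ofReal (a ^ β) * annulusConst β := by
  split_ifs with h0
  · subst h0; norm_num
  have ha' : 0 < a := lt_of_le_of_ne ha (Ne.symm h0)
  set F : ℝ → ℝ≥0∞ := fun r => (Ioo (a / 2) a).indicator
      (fun r => ENNReal.ofReal (r ^ (β - 1))) r with hF
  have h1 : ∫⁻ r in Ioi (0 : ℝ), {r : ℝ | 1 < r⁻¹ * a ∧ r⁻¹ * a < 2}.indicator
      (fun r => ENNReal.ofReal (r ^ (β - 1))) r = ∫⁻ r, F r := by
    rw [← lintegral_indicator measurableSet_Ioi]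
    congr 1 with r
    by_cases hr : 0 < r
    · rw [indicator_of_mem (mem_Ioi.2 hr)]
      simp only [hF]
      have : r ∈ {r : ℝ | 1 < r⁻¹ * a ∧ r⁻¹ * a < 2} ↔ r ∈ Ioo (a / 2) a := by
        simp only [mem_ofPred_eq, mem_Ioo, ← div_eq_inv_mul, lt_div_iff₀ hr, div_lt_iff₀ hr]
        constructor <;> rintro ⟨h1, h2⟩ <;> constructor <;> linarith
      by_cases hm : r ∈ Ioo (a / 2) a
      · rw [indicator_of_mem hm, indicator_of_mem (this.2 hm)]
      · rw [indicator_of_notMem hm, indicator_of_notMem (fun h => hm (this.1 h))]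
    · rw [indicator_of_notMem (by simpa using hr)]
      refine (indicator_of_notMem ?_ _).symm
      rintro ⟨h1, -⟩
      linarith
  rw [h1]
  have h2 := lintegral_comp_const_smul (E := ℝ) volume F ha'.ne'
  have h3 : ∫⁻ r, F (a • r) = ENNReal.ofReal (a ^ (β - 1)) * annulusConst β := by
    rw [annulusConst, ← lintegral_indicator measurableSet_Ioo,
      ← lintegral_const_mul' _ _ ENNReal.ofReal_ne_top]
    congr 1 with r
    rw [hF]
    simp only [smul_eq_mul]
    have : a * r ∈ Ioo (a / 2) a ↔ r ∈ Ioo (1 / 2 : ℝ) 1 := by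
      simp only [mem_Ioo]
      constructor <;> rintro ⟨h1, h2⟩ <;> constructor <;> nlinarith
    by_cases hm : r ∈ Ioo (1 / 2 : ℝ) 1
    · rw [indicator_of_mem hm, indicator_of_mem (this.2 hm),
        Real.mul_rpow ha'.le (by linarith [hm.1]), ENNReal.ofReal_mul (by positivity)]
    · rw [indicator_of_notMem hm, indicator_of_notMem (fun h => hm (this.1 h)), mul_zero]
  rw [h3] at h2
  simp only [Module.finrank_self, pow_one, abs_of_pos (inv_pos.2 ha')] at h2
  have h4 : ENNReal.ofReal a * ENNReal.ofReal a⁻¹ = 1 := by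
    rw [← ENNReal.ofReal_mul ha'.le, mul_inv_cancel₀ ha'.ne', ENNReal.ofReal_one]
  calc ∫⁻ r, F r = ENNReal.ofReal a * (ENNReal.ofReal a⁻¹ * ∫⁻ r, F r) := by
        rw [← mul_assoc, h4, one_mul]
    _ = _ := by
        rw [← h2, ← mul_assoc, ← ENNReal.ofReal_mul ha'.le]
        congr 2
        rw [Real.rpow_sub_one ha'.ne']; field_simp

/-- Integration against `‖h‖ ^ (γ - dim E)`, in dilated annuli. -/
theorem lintegral_annulus_dilation (γ : ℝ) {f : E → ℝ≥0∞} (hf : Measurable f) :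
    ∫⁻ h in unitAnnulus E, ∫⁻ r in Ioi (0 : ℝ), f (r • h) * ENNReal.ofReal (r ^ (γ - 1)) ∂volume ∂μ =
      annulusConst (γ - Module.finrank ℝ E) *
        ∫⁻ h in {h : E | h ≠ 0}, f h * ENNReal.ofReal (‖h‖ ^ (γ - Module.finrank ℝ E)) ∂μ := by
  set d : ℕ := Module.finrank ℝ E
  have hA : MeasurableSet (unitAnnulus E) := measurableSet_unitAnnulus
  have hz : MeasurableSet {h : E | h ≠ 0} := (measurableSet_singleton (0 : E)).compl
  have hmA : Measurable (fun q : ℝ × E => (unitAnnulus E).indicator (fun _ => (1 : ℝ≥0∞)) (q.1⁻¹ • q.2)) :=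
    (measurable_const.indicator hA).comp (measurable_fst.inv.smul measurable_snd)
  rw [lintegral_lintegral_swap (by fun_prop)]
  -- Undoing the dilation by `r` costs the Jacobian `r ^ (-d)`. After the swap, the integral over
  -- `r` at fixed `h` is a slice with exponent `β = γ - d`.
  have h1 : ∀ r ∈ Ioi (0 : ℝ), ∫⁻ h in unitAnnulus E, f (r • h) * ENNReal.ofReal (r ^ (γ - 1)) ∂μ =
      ∫⁻ h, (unitAnnulus E).indicator (fun _ => (1 : ℝ≥0∞)) (r⁻¹ • h) * f h *
        ENNReal.ofReal (r ^ (γ - d - 1)) ∂μ := by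
    intro r hr
    have hr : 0 < r := hr
    rw [← lintegral_indicator hA]
    have := lintegral_comp_const_smul μ (fun h : E => (unitAnnulus E).indicator (fun _ => (1 : ℝ≥0∞))
      (r⁻¹ • h) * f h * ENNReal.ofReal (r ^ (γ - 1))) hr.ne'
    have h' : (fun h => (unitAnnulus E).indicator
        (fun h => f (r • h) * ENNReal.ofReal (r ^ (γ - 1))) h) = fun h : E =>
        (unitAnnulus E).indicator (fun _ => (1 : ℝ≥0∞))
          (r⁻¹ • (r • h)) * f (r • h) * ENNReal.ofReal (r ^ (γ - 1)) := by
      ext h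
      rw [inv_smul_smul₀ hr.ne']
      by_cases hh : h ∈ unitAnnulus E
      · simp [hh]
      · simp [hh]
    rw [h', this, ← lintegral_const_mul' _ _ ENNReal.ofReal_ne_top]
    congr 1 with h
    rw [mul_comm, mul_assoc, ← ENNReal.ofReal_mul (by positivity)]
    congr 2
    rw [abs_of_pos (by positivity), show γ - d - 1 = γ - 1 - d by ring, Real.rpow_sub hr (γ - 1),
      Real.rpow_natCast, div_eq_mul_inv]
  rw [setLIntegral_congr_fun measurableSet_Ioi h1, lintegral_lintegral_swap (by fun_prop),
    ← lintegral_const_mul' _ _ (annulusConst_ne_top _), ← lintegral_indicator hz]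
  congr 1 with h
  have h2 := lintegral_annulus_slice (γ - d) (norm_nonneg h)
  have h3 : ∫⁻ r in Ioi (0 : ℝ), (unitAnnulus E).indicator (fun _ => (1 : ℝ≥0∞)) (r⁻¹ • h) * f h *
        ENNReal.ofReal (r ^ (γ - d - 1)) = f h * ∫⁻ r in Ioi (0 : ℝ),
        {r : ℝ | 1 < r⁻¹ * ‖h‖ ∧ r⁻¹ * ‖h‖ < 2}.indicator
      (fun r => ENNReal.ofReal (r ^ (γ - d - 1))) r := by
    rw [← lintegral_const_mul]
    · refine setLIntegral_congr_fun measurableSet_Ioi fun r hr => ?_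
      have hr : 0 < r := hr
      have : r⁻¹ • h ∈ unitAnnulus E ↔ r ∈ {r : ℝ | 1 < r⁻¹ * ‖h‖ ∧ r⁻¹ * ‖h‖ < 2} := by
        simp [unitAnnulus, norm_smul, abs_of_pos hr]
      by_cases hh : r ∈ {r : ℝ | 1 < r⁻¹ * ‖h‖ ∧ r⁻¹ * ‖h‖ < 2}
      · simp only [indicator_of_mem hh, indicator_of_mem (this.2 hh), one_mul]
      · simp only [indicator_of_notMem hh, indicator_of_notMem (fun h' => hh (this.1 h')), zero_mul,
          mul_zero]
    · refine Measurable.indicator (by fun_prop) ?_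
      have hm : Measurable fun r : ℝ => r⁻¹ * ‖h‖ := by fun_prop
      exact (measurableSet_lt measurable_const hm).inter (measurableSet_lt hm measurable_const)
  rw [h3, h2]
  by_cases h0 : h = 0
  · simp [h0]
  · rw [if_neg (by simpa using h0), indicator_of_mem (by simpa using h0)]
    ring

end Haar

theorem nuMeasure_apply (N : ℕ) (γ : ℝ)
    {S : Set (EuclideanSpace ℝ (Fin N) × EuclideanSpace ℝ (Fin N))} (hS : MeasurableSet S) :
    nuMeasure N γ S = ∫⁻ x, ∫⁻ h in {h : EuclideanSpace ℝ (Fin N) | h ≠ 0},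
      S.indicator 1 (x, x + h) * ENNReal.ofReal (‖h‖ ^ (γ - N)) := by
  have hD : MeasurableSet {z : EuclideanSpace ℝ (Fin N) × EuclideanSpace ℝ (Fin N) | z.1 ≠ z.2} :=
    (measurableSet_eq_fun measurable_fst measurable_snd).compl
  have hz : MeasurableSet {h : EuclideanSpace ℝ (Fin N) | h ≠ 0} :=
    (measurableSet_singleton 0).compl
  have hw : Measurable fun z : EuclideanSpace ℝ (Fin N) × EuclideanSpace ℝ (Fin N) =>
      ENNReal.ofReal (‖z.1 - z.2‖ ^ (γ - (N : ℝ))) := by fun_prop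
  rw [nuMeasure, withDensity_apply _ hS, ← lintegral_indicator hS, ← lintegral_indicator hD,
    Measure.volume_eq_prod, lintegral_prod _ ((hw.indicator hS).indicator hD).aemeasurable]
  congr 1 with x
  rw [← lintegral_add_left_eq_self _ x, ← lintegral_indicator hz]
  congr 1 with h
  by_cases h0 : h = 0
  · subst h0; simp
  · rw [indicator_of_mem (s := {h : EuclideanSpace ℝ (Fin N) | h ≠ 0}) h0, indicator_of_mem]
    · by_cases hm : (x, x + h) ∈ S
      · simp [hm]
      · simp [hm]
    · simpa using h0

/-- The measure `nuMeasure` in dilated annuli. -/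
theorem annulusConst_mul_nuMeasure (N : ℕ) (γ : ℝ)
    {S : Set (EuclideanSpace ℝ (Fin N) × EuclideanSpace ℝ (Fin N))} (hS : MeasurableSet S) :
    annulusConst (γ - N) * nuMeasure N γ S =
      ∫⁻ h in unitAnnulus (EuclideanSpace ℝ (Fin N)), ∫⁻ x : EuclideanSpace ℝ (Fin N),
        ∫⁻ r in Ioi (0 : ℝ), S.indicator 1 (x, x + r • h) * ENNReal.ofReal (r ^ (γ - 1)) := by
  have h1 : Measurable (S.indicator
      (1 : EuclideanSpace ℝ (Fin N) × EuclideanSpace ℝ (Fin N) → ℝ≥0∞)) := measurable_one.indicator hS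
  rw [nuMeasure_apply N γ hS, ← lintegral_const_mul' _ _ (annulusConst_ne_top _),
    lintegral_lintegral_swap]
  · congr 1 with x
    have := lintegral_annulus_dilation volume γ
      (f := fun h : EuclideanSpace ℝ (Fin N) => S.indicator 1 (x, x + h)) (by fun_prop)
    simp only [finrank_euclideanSpace_fin] at this
    exact this.symm
  · exact Measurable.aemeasurable (Measurable.lintegral_prod_right' (f := fun q :
      (EuclideanSpace ℝ (Fin N) × EuclideanSpace ℝ (Fin N)) × ℝ =>
        S.indicator 1 (q.1.2, q.1.2 + q.2 • q.1.1) * ENNReal.ofReal (q.2 ^ (γ - 1))) (by fun_prop))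

/-! ### A directional maximal function -/

section Maximal

/-- The mean of `f` over the segment from `x` to `x + ρ h`. -/
def dirAvg {E : Type*} [AddCommGroup E] [Module ℝ E] (f : E → ℝ≥0∞) (h : E) (ρ : ℝ) (x : E) :
    ℝ≥0∞ :=
  (ENNReal.ofReal ρ)⁻¹ * ∫⁻ τ in Ioo 0 ρ, f (x + τ • h)

/-- The maximal function of `f` in direction `h` over the lengths `R / 2 ^ j`. -/
def dirMax {E : Type*} [AddCommGroup E] [Module ℝ E] (f : E → ℝ≥0∞) (h : E) (R : ℝ) (x : E) :
    ℝ≥0∞ :=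
  ⨆ j : ℕ, dirAvg f h (R / 2 ^ j) x

variable {E : Type*} [NormedAddCommGroup E] [NormedSpace ℝ E] [MeasurableSpace E] [BorelSpace E]
  [FiniteDimensional ℝ E]

theorem measurable_dirAvg {f : E → ℝ≥0∞} (hf : Measurable f) (h : E) (ρ : ℝ) :
    Measurable (dirAvg f h ρ) := by
  refine Measurable.const_mul ?_ _
  exact Measurable.lintegral_prod_right' (f := fun q : E × ℝ => f (q.1 + q.2 • h)) (by fun_prop)

theorem measurable_dirMax {f : E → ℝ≥0∞} (hf : Measurable f) (h : E) (R : ℝ) :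
    Measurable (dirMax f h R) :=
  Measurable.iSup fun _ => measurable_dirAvg hf h _

theorem dirAvg_one_eq (f : ℝ → ℝ≥0∞) (ρ s : ℝ) :
    dirAvg f 1 ρ s = (ENNReal.ofReal ρ)⁻¹ * ∫⁻ τ in Ioo s (s + ρ), f τ := by
  rw [dirAvg, ← lintegral_indicator measurableSet_Ioo, ← lintegral_indicator measurableSet_Ioo,
    ← lintegral_add_left_eq_self ((Ioo s (s + ρ)).indicator f) s]
  congr 2 with τ
  simp only [smul_eq_mul, mul_one]
  by_cases hm : τ ∈ Ioo 0 ρ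
  · rw [indicator_of_mem hm, indicator_of_mem]
    exact ⟨by linarith [hm.1], by linarith [hm.2]⟩
  · rw [indicator_of_notMem hm, indicator_of_notMem]
    rintro ⟨h1, h2⟩
    exact hm ⟨by linarith, by linarith⟩

/-- The weak-type bound for the one-sided maximal function on the line. -/
theorem mul_volume_lt_dirMax_le (f : ℝ → ℝ≥0∞) {R : ℝ} (hR : 0 < R) (t : ℝ≥0∞) :
    t * volume {s | t < dirMax f 1 R s} ≤ 5 * ∫⁻ s, f s := by
  have hex : ∀ s ∈ {s | t < dirMax f 1 R s}, ∃ ρ : ℝ, 0 < ρ ∧ ρ ≤ R ∧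
      t * ENNReal.ofReal ρ ≤ ∫⁻ τ in Ioo s (s + ρ), f τ := by
    intro s hs
    obtain ⟨j, hj⟩ := lt_iSup_iff.1 (show t < ⨆ j : ℕ, dirAvg f 1 (R / 2 ^ j) s from hs)
    have hρ : 0 < R / 2 ^ j := by positivity
    refine ⟨R / 2 ^ j, hρ, div_le_self hR.le (one_le_pow₀ (by norm_num)), ?_⟩
    rw [dirAvg_one_eq] at hj
    calc t * ENNReal.ofReal (R / 2 ^ j)
        ≤ ((ENNReal.ofReal (R / 2 ^ j))⁻¹ * ∫⁻ τ in Ioo s (s + R / 2 ^ j), f τ) *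
          ENNReal.ofReal (R / 2 ^ j) := by gcongr
      _ = _ := by
        rw [mul_comm, ← mul_assoc, ENNReal.mul_inv_cancel, one_mul]
        · simpa using hρ
        · exact ENNReal.ofReal_ne_top
  choose! ρ hρ hρR hρf using hex
  -- The intervals `[s, s + ρ s]` are written as balls centred at their midpoints. The bound `ρ s ≤
  -- R` supplies the bounded radii that the Vitali covering lemma requires, and its enlargement
  -- factor is the 5 in the estimate.
  obtain ⟨u, huS, hdisj, hcov⟩ := Vitali.exists_disjoint_subfamily_covering_enlargement_closedBall
    {s | t < dirMax f 1 R s} (fun s => s + ρ s / 2) (fun s => ρ s / 2) R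
    (fun s hs => by linarith [hρR s hs, hρ s hs]) 5 (by norm_num)
  have hcount : u.Countable := by
    refine hdisj.countable_of_nonempty_interior fun s hs => ?_
    refine ⟨s + ρ s / 2, ball_subset_interior_closedBall (mem_ball_self ?_)⟩
    exact half_pos (hρ s (huS hs))
  have hsub : {s | t < dirMax f 1 R s} ⊆ ⋃ b ∈ u, closedBall (b + ρ b / 2) (5 * (ρ b / 2)) := by
    intro s hs
    obtain ⟨b, hb, hsb⟩ := hcov s hs
    refine mem_iUnion₂.2 ⟨b, hb, hsb ?_⟩
    rw [mem_closedBall, Real.dist_eq, abs_le]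
    constructor <;> linarith [hρ s hs]
  have := hcount.to_subtype
  calc t * volume {s | t < dirMax f 1 R s}
      ≤ t * ∑' b : u, volume (closedBall ((b : ℝ) + ρ b / 2) (5 * (ρ b / 2))) := by
        gcongr
        exact (measure_mono hsub).trans (measure_biUnion_le volume hcount _)
    _ = ∑' b : u, t * volume (closedBall ((b : ℝ) + ρ b / 2) (5 * (ρ b / 2))) :=
        ENNReal.tsum_mul_left.symm
    _ ≤ ∑' b : u, 5 * ∫⁻ τ in closedBall ((b : ℝ) + ρ b / 2) (ρ b / 2), f τ := by
        refine ENNReal.tsum_le_tsum fun b => ?_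
        have hb := huS b.2
        rw [Real.volume_closedBall, show 2 * (5 * (ρ (b : ℝ) / 2)) = 5 * ρ b by ring,
          ENNReal.ofReal_mul (by norm_num), mul_left_comm]
        rw [show ENNReal.ofReal 5 = 5 by simp]
        gcongr
        refine (hρf _ hb).trans (lintegral_mono_set fun s hs => ?_)
        rw [mem_closedBall, Real.dist_eq, abs_le]
        constructor <;> linarith [hs.1, hs.2]
    _ = 5 * ∫⁻ τ in ⋃ b ∈ u, closedBall ((b : ℝ) + ρ b / 2) (ρ b / 2), f τ := by
        rw [ENNReal.tsum_mul_left, lintegral_biUnion hcount (fun _ _ => measurableSet_closedBall)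
          hdisj]
    _ ≤ 5 * ∫⁻ s, f s := by
        gcongr
        exact Measure.restrict_le_self

/-- Layer-cake formula: the power integral with `γ = p`, where the threshold condition is simply `t
< a`. -/
theorem ENNReal.rpow_eq_lintegral {p : ℝ} (hp : 0 < p) (a : ℝ≥0∞) :
    a ^ p = ENNReal.ofReal p * ∫⁻ t in Ioi (0 : ℝ), {t : ℝ | ENNReal.ofReal t < a}.indicator
      (fun t => ENNReal.ofReal (t ^ (p - 1))) t := by
  have := lintegral_rpow_sub_one_indicator hp hp.ne' a
  simp only [div_self hp.ne', Real.rpow_one] at this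
  rw [this, mul_left_comm, ← ENNReal.ofReal_mul hp.le, abs_of_pos hp, mul_inv_cancel₀ hp.ne']
  simp

theorem dirMax_le_add {f g : E → ℝ≥0∞} (hg : Measurable g) {c : ℝ≥0∞} (hfg : ∀ x, f x ≤ g x + c)
    (h : E) {R : ℝ} (hR : 0 < R) (x : E) : dirMax f h R x ≤ dirMax g h R x + c := by
  refine iSup_le fun j => ?_
  have hρ : 0 < R / 2 ^ j := by positivity
  calc dirAvg f h (R / 2 ^ j) x
      ≤ (ENNReal.ofReal (R / 2 ^ j))⁻¹ * ∫⁻ τ in Ioo 0 (R / 2 ^ j), (g (x + τ • h) + c) := by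
        unfold dirAvg
        gcongr
        exact hfg _
    _ = dirAvg g h (R / 2 ^ j) x + c := by
        rw [lintegral_add_left (by fun_prop), mul_add, dirAvg, setLIntegral_const,
          Real.volume_Ioo, sub_zero, mul_comm c, ← mul_assoc, ENNReal.inv_mul_cancel, one_mul]
        · simpa using hρ
        · exact ENNReal.ofReal_ne_top
    _ ≤ _ := by
        gcongr
        exact le_iSup (fun j : ℕ => dirAvg g h (R / 2 ^ j) x) j

/-- Values of `f` up to `t / 2` contribute at most `t / 2` to any average, so the part of `f` above
`t / 2` must have maximal function above `t / 2`. The weak-type bound at level `t / 2` gives `10 = 5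
* 2`. -/
theorem volume_lt_dirMax_le {f : ℝ → ℝ≥0∞} (hf : Measurable f) {R t : ℝ} (hR : 0 < R) (ht : 0 < t) :
    volume {s | ENNReal.ofReal t < dirMax f 1 R s} ≤ ENNReal.ofReal (10 * t⁻¹) *
      ∫⁻ s, {s | ENNReal.ofReal t < 2 * f s}.indicator f s := by
  have hm : MeasurableSet {s | ENNReal.ofReal t < 2 * f s} :=
    measurableSet_lt measurable_const (by fun_prop)
  set g := {s | ENNReal.ofReal t < 2 * f s}.indicator f with hg
  have h2 : ENNReal.ofReal t = 2 * ENNReal.ofReal (t / 2) := by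
    rw [show (2 : ℝ≥0∞) = ENNReal.ofReal 2 by simp, ← ENNReal.ofReal_mul (by norm_num)]
    congr 1; ring
  have hfg : ∀ s, f s ≤ g s + ENNReal.ofReal (t / 2) := by
    intro s
    by_cases hs : s ∈ {s | ENNReal.ofReal t < 2 * f s}
    · rw [hg, indicator_of_mem hs]; exact le_self_add
    · rw [hg, indicator_of_notMem hs, zero_add]
      have : ¬ (ENNReal.ofReal t < 2 * f s) := hs
      rw [h2, not_lt] at this
      exact (ENNReal.mul_le_mul_iff_right (by norm_num) (by norm_num)).1 this
  have hsub : {s | ENNReal.ofReal t < dirMax f 1 R s} ⊆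
      {s | ENNReal.ofReal (t / 2) < dirMax g 1 R s} := by
    intro s hs
    have h3 : ENNReal.ofReal (t / 2) + ENNReal.ofReal (t / 2) <
        dirMax g 1 R s + ENNReal.ofReal (t / 2) := by
      rw [← two_mul, ← h2]
      exact lt_of_lt_of_le hs (dirMax_le_add (hf.indicator hm) hfg 1 hR s)
    exact lt_of_add_lt_add_right h3
  have h4 := mul_volume_lt_dirMax_le g hR (ENNReal.ofReal (t / 2))
  calc volume {s | ENNReal.ofReal t < dirMax f 1 R s}
      ≤ volume {s | ENNReal.ofReal (t / 2) < dirMax g 1 R s} := measure_mono hsub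
    _ = ENNReal.ofReal (2 * t⁻¹) * (ENNReal.ofReal (t / 2) *
          volume {s | ENNReal.ofReal (t / 2) < dirMax g 1 R s}) := by
        rw [← mul_assoc, ← ENNReal.ofReal_mul (by positivity),
          show 2 * t⁻¹ * (t / 2) = 1 by field_simp, ENNReal.ofReal_one, one_mul]
    _ ≤ ENNReal.ofReal (2 * t⁻¹) * (5 * ∫⁻ s, g s) := by gcongr
    _ = _ := by
        rw [← mul_assoc, show (5 : ℝ≥0∞) = ENNReal.ofReal 5 by simp,
          ← ENNReal.ofReal_mul (by positivity)]
        congr 2; ring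

/-- The constant in the strong-type bound for the one-sided maximal function. -/
def maximalConst (p : ℝ) : ℝ≥0 := (10 * p * 2 ^ (p - 1) / (p - 1)).toNNReal

/-- Marcinkiewicz interpolation: insert the truncated weak bound into the layer-cake formula and
swap. The inner integral of `t ^ (p - 2)` over `0 < t < 2 f` equals `(2 f) ^ (p - 1) / (p - 1)`,
which is where `p > 1` enters. -/
theorem lintegral_dirMax_one_rpow_le {p : ℝ} (hp : 1 < p) {f : ℝ → ℝ≥0∞} (hf : Measurable f)
    {R : ℝ} (hR : 0 < R) :
    ∫⁻ s, dirMax f 1 R s ^ p ≤ maximalConst p * ∫⁻ s, f s ^ p := by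
  have hp0 : 0 < p := by linarith
  have hp1 : 0 < p - 1 := by linarith
  have hM := measurable_dirMax hf 1 R
  have hset : MeasurableSet {q : ℝ × ℝ | ENNReal.ofReal q.2 < dirMax f 1 R q.1} :=
    measurableSet_lt (by fun_prop) (by fun_prop)
  have hset2 : MeasurableSet {q : ℝ × ℝ | ENNReal.ofReal q.1 < 2 * f q.2} :=
    measurableSet_lt (by fun_prop) (by fun_prop)
  calc ∫⁻ s, dirMax f 1 R s ^ p
      = ENNReal.ofReal p * ∫⁻ s, ∫⁻ t in Ioi (0 : ℝ),
          {t : ℝ | ENNReal.ofReal t < dirMax f 1 R s}.indicator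
            (fun t => ENNReal.ofReal (t ^ (p - 1))) t := by
        rw [← lintegral_const_mul' _ _ ENNReal.ofReal_ne_top]
        congr 1 with s
        exact ENNReal.rpow_eq_lintegral hp0 _
    _ = ENNReal.ofReal p * ∫⁻ t in Ioi (0 : ℝ), ∫⁻ s,
          {t : ℝ | ENNReal.ofReal t < dirMax f 1 R s}.indicator
            (fun t => ENNReal.ofReal (t ^ (p - 1))) t := by
        rw [lintegral_lintegral_swap]
        exact ((show Measurable fun q : ℝ × ℝ => ENNReal.ofReal (q.2 ^ (p - 1)) by
          fun_prop).indicator hset).aemeasurable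
    _ ≤ ENNReal.ofReal p * ∫⁻ t in Ioi (0 : ℝ), ∫⁻ s, ENNReal.ofReal 10 * f s *
          {t : ℝ | ENNReal.ofReal t < 2 * f s}.indicator
            (fun t => ENNReal.ofReal (t ^ (p - 1 - 1))) t := by
        refine mul_le_mul' le_rfl ?_
        refine setLIntegral_mono' (measurableSet_Ioi (a := (0 : ℝ))) fun t ht => ?_
        have ht : 0 < t := ht
        have e1 : ∫⁻ s, {t : ℝ | ENNReal.ofReal t < dirMax f 1 R s}.indicator
            (fun t => ENNReal.ofReal (t ^ (p - 1))) t =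
            ENNReal.ofReal (t ^ (p - 1)) * volume {s | ENNReal.ofReal t < dirMax f 1 R s} := by
          rw [← lintegral_indicator_const (measurableSet_lt measurable_const hM)]
          rfl
        rw [e1]
        refine (mul_le_mul_right (volume_lt_dirMax_le hf hR ht) _).trans (le_of_eq ?_)
        rw [← mul_assoc, ← ENNReal.ofReal_mul (by positivity),
          ← lintegral_const_mul' _ _ ENNReal.ofReal_ne_top]
        congr 1 with s
        by_cases hs : ENNReal.ofReal t < 2 * f s
        · rw [indicator_of_mem (show s ∈ {s | ENNReal.ofReal t < 2 * f s} from hs),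
            indicator_of_mem (show t ∈ {t : ℝ | ENNReal.ofReal t < 2 * f s} from hs),
            mul_right_comm, ← ENNReal.ofReal_mul (by positivity), Real.rpow_sub_one ht.ne' (p - 1)]
          congr 2; field_simp
        · rw [indicator_of_notMem (show s ∉ {s | ENNReal.ofReal t < 2 * f s} from hs),
            indicator_of_notMem (show t ∉ {t : ℝ | ENNReal.ofReal t < 2 * f s} from hs)]
          simp
    _ = ENNReal.ofReal p * ∫⁻ s, ∫⁻ t in Ioi (0 : ℝ), ENNReal.ofReal 10 * f s *
          {t : ℝ | ENNReal.ofReal t < 2 * f s}.indicator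
            (fun t => ENNReal.ofReal (t ^ (p - 1 - 1))) t := by
        rw [lintegral_lintegral_swap]
        refine Measurable.aemeasurable (Measurable.mul (by fun_prop) ?_)
        exact (show Measurable fun q : ℝ × ℝ => ENNReal.ofReal (q.1 ^ (p - 1 - 1)) by
          fun_prop).indicator hset2
    _ = ENNReal.ofReal p * ∫⁻ s, ENNReal.ofReal (10 * 2 ^ (p - 1) * (p - 1)⁻¹) * f s ^ p := by
        congr 2 with s
        rw [lintegral_const_mul]
        · have := lintegral_rpow_sub_one_indicator hp1 hp1.ne' (2 * f s)
          simp only [div_self hp1.ne', Real.rpow_one] at this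
          rw [this, ENNReal.mul_rpow_of_nonneg _ _ hp1.le, abs_of_pos hp1]
          rw [show (2 : ℝ≥0∞) = ENNReal.ofReal 2 by simp, ENNReal.ofReal_rpow_of_pos (by norm_num)]
          rw [ENNReal.ofReal_mul (by positivity), ENNReal.ofReal_mul (by positivity)]
          have : f s ^ p = f s * f s ^ (p - 1) := by
            nth_rw 2 [← ENNReal.rpow_one (f s)]
            rw [← ENNReal.rpow_add_of_nonneg _ _ zero_le_one hp1.le]
            congr 1; ring
          rw [this]; ring
        · exact (show Measurable fun t : ℝ => ENNReal.ofReal (t ^ (p - 1 - 1)) by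
            fun_prop).indicator (measurableSet_lt ENNReal.measurable_ofReal measurable_const)
    _ = _ := by
        rw [lintegral_const_mul' _ _ ENNReal.ofReal_ne_top, ← mul_assoc,
          ← ENNReal.ofReal_mul hp0.le, maximalConst, ENNReal.ofReal]
        congr 3; ring

/-- The strong-type bound for the directional maximal function, by transference from the line. -/
theorem lintegral_dirMax_rpow_le (μ : Measure E) [μ.IsAddHaarMeasure] {p : ℝ} (hp : 1 < p)
    {f : E → ℝ≥0∞} (hf : Measurable f) (h : E) {R : ℝ} (hR : 0 < R) :
    ∫⁻ x, dirMax f h R x ^ p ∂μ ≤ 2 * maximalConst p * ∫⁻ x, f x ^ p ∂μ := by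
  have hp0 : 0 < p := by linarith
  have hM := measurable_dirMax hf h R
  -- The window `(0, 2R)` contains every segment of length at most `R` that starts in `(0, R)`, so
  -- cutting `f` off outside it leaves the relevant averages unchanged.
  set F : E → ℝ → ℝ≥0∞ := fun x => (Ioo 0 (2 * R)).indicator fun τ => f (x + τ • h) with hF
  have hFm : ∀ x, Measurable (F x) := fun x =>
    (show Measurable fun τ : ℝ => f (x + τ • h) by fun_prop).indicator measurableSet_Ioo
  have hle : ∀ x : E, ∀ σ ∈ Ioo 0 R, dirMax f h R (x + σ • h) ≤ dirMax (F x) 1 R σ := by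
    intro x σ hσ
    refine iSup_mono fun j => ?_
    unfold dirAvg
    refine mul_le_mul' le_rfl ?_
    refine setLIntegral_mono' (measurableSet_Ioo (a := (0 : ℝ)) (b := R / 2 ^ j)) fun τ hτ => ?_
    have : R / 2 ^ j ≤ R := div_le_self hR.le (one_le_pow₀ (by norm_num))
    simp only [hF, smul_eq_mul, mul_one]
    rw [indicator_of_mem, add_assoc, ← add_smul]
    exact ⟨by linarith [hσ.1, hτ.1], by linarith [hσ.2, hτ.2]⟩
  have hxs : Measurable fun q : E × ℝ => dirMax f h R (q.1 + q.2 • h) ^ p := by fun_prop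
  have hxf : Measurable fun q : E × ℝ => f (q.1 + q.2 • h) ^ p := by fun_prop
  -- By translation invariance, averaging over the shifts `x + σ h` with `0 < σ < R` changes
  -- nothing. The factor 2 is the ratio of the window length `2R` to `R`.
  have key : ENNReal.ofReal R * ∫⁻ x, dirMax f h R x ^ p ∂μ ≤
      ENNReal.ofReal R * (2 * maximalConst p * ∫⁻ x, f x ^ p ∂μ) := by
    calc ENNReal.ofReal R * ∫⁻ x, dirMax f h R x ^ p ∂μ
        = ∫⁻ σ in Ioo 0 R, ∫⁻ x, dirMax f h R (x + σ • h) ^ p ∂μ := by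
          simp_rw [lintegral_add_right_eq_self (fun x => dirMax f h R x ^ p)]
          rw [setLIntegral_const, Real.volume_Ioo, sub_zero, mul_comm]
      _ = ∫⁻ x, ∫⁻ σ in Ioo 0 R, dirMax f h R (x + σ • h) ^ p ∂volume ∂μ :=
          (lintegral_lintegral_swap hxs.aemeasurable).symm
      _ ≤ ∫⁻ x, ∫⁻ σ, dirMax (F x) 1 R σ ^ p ∂volume ∂μ := by
          refine lintegral_mono fun x => ?_
          refine (setLIntegral_mono' measurableSet_Ioo fun σ hσ => ?_).trans
            (setLIntegral_le_lintegral (Ioo 0 R) _)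
          exact ENNReal.rpow_le_rpow (hle x σ hσ) hp0.le
      _ ≤ ∫⁻ x, maximalConst p * ∫⁻ τ, F x τ ^ p ∂volume ∂μ :=
          lintegral_mono fun x => lintegral_dirMax_one_rpow_le hp (hFm x) hR
      _ = maximalConst p * ∫⁻ x, ∫⁻ τ in Ioo 0 (2 * R), f (x + τ • h) ^ p ∂volume ∂μ := by
          rw [lintegral_const_mul' _ _ ENNReal.coe_ne_top]
          congr 2 with x
          rw [← lintegral_indicator measurableSet_Ioo]
          congr 1 with τ
          simp only [hF]
          by_cases hτ : τ ∈ Ioo 0 (2 * R)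
          · rw [indicator_of_mem hτ, indicator_of_mem hτ]
          · rw [indicator_of_notMem hτ, indicator_of_notMem hτ, ENNReal.zero_rpow_of_pos hp0]
      _ = maximalConst p * ∫⁻ τ in Ioo 0 (2 * R), ∫⁻ x, f (x + τ • h) ^ p ∂μ := by
          rw [lintegral_lintegral_swap hxf.aemeasurable]
      _ = _ := by
          simp_rw [lintegral_add_right_eq_self (fun x => f x ^ p)]
          rw [setLIntegral_const, Real.volume_Ioo, sub_zero, ENNReal.ofReal_mul (by norm_num)]
          rw [show ENNReal.ofReal 2 = 2 by simp]
          ring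
  exact (ENNReal.mul_le_mul_iff_right (by simpa using hR) ENNReal.ofReal_ne_top).1 key

end Maximal

/-! ### The weak `L^p` quasi-norm -/

section WeakLp

variable {α : Type*} [MeasurableSpace α] {μ : Measure α} {p : ℝ}

theorem weakLpNorm_le_of_forall {F : α → ℝ} (hp : 0 < p) {B : ℝ≥0∞}
    (h : ∀ t : ℝ, 0 < t → ENNReal.ofReal t ^ p * μ {z | t < |F z|} ≤ B ^ p) :
    weakLpNorm F p μ ≤ B := by
  refine iSup₂_le fun t ht => ?_
  have := ENNReal.rpow_le_rpow (h t ht) (one_div_pos.2 hp).le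
  rwa [ENNReal.mul_rpow_of_nonneg _ _ (one_div_pos.2 hp).le, ← ENNReal.rpow_mul,
    ← ENNReal.rpow_mul, mul_one_div_cancel hp.ne', ENNReal.rpow_one, ENNReal.rpow_one] at this

theorem ofReal_rpow_mul_le_weakLpNorm_rpow (F : α → ℝ) (hp : 0 < p) {t : ℝ} (ht : 0 < t) :
    ENNReal.ofReal t ^ p * μ {z | t < |F z|} ≤ weakLpNorm F p μ ^ p := by
  have h1 : ENNReal.ofReal t * μ {z | t < |F z|} ^ (1 / p) ≤ weakLpNorm F p μ :=
    le_iSup₂ (f := fun (t : ℝ) (_ : 0 < t) => ENNReal.ofReal t * μ {z | t < |F z|} ^ (1 / p)) t ht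
  have := ENNReal.rpow_le_rpow h1 hp.le
  rwa [ENNReal.mul_rpow_of_nonneg _ _ hp.le, ← ENNReal.rpow_mul, one_div_mul_cancel hp.ne',
    ENNReal.rpow_one] at this

theorem eLpNorm_ofReal_rpow_eq {F : Type*} [NormedAddCommGroup F] (f : α → F) (hp : 0 < p) :
    eLpNorm f (ENNReal.ofReal p) μ ^ p = ∫⁻ x, ‖f x‖ₑ ^ p ∂μ := by
  rw [eLpNorm_eq_lintegral_rpow_enorm_toReal (by simpa using hp) ENNReal.ofReal_ne_top,
    ENNReal.toReal_ofReal hp.le, ← ENNReal.rpow_mul, one_div_mul_cancel hp.ne', ENNReal.rpow_one]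

theorem weakLpNorm_congr_ae {F G : α → ℝ} (h : F =ᵐ[μ] G) :
    weakLpNorm F p μ = weakLpNorm G p μ := by
  unfold weakLpNorm
  congr! 5 with t ht
  refine measure_congr ?_
  filter_upwards [h] with z hz
  exact congrArg (fun a => t < |a|) hz

end WeakLp

theorem measurable_diffQuot {N : ℕ} {u : EuclideanSpace ℝ (Fin N) → ℝ}
    (hu : Measurable u) (b : ℝ) : Measurable (diffQuot b u) := by
  unfold diffQuot
  fun_prop

/-! ### The upper bound for continuously differentiable functions -/

section Upper

variable {E : Type*} [NormedAddCommGroup E] [NormedSpace ℝ E] [MeasurableSpace E] [BorelSpace E]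
  [FiniteDimensional ℝ E]

theorem monotone_dirMax_two_pow (f : E → ℝ≥0∞) (h x : E) :
    Monotone fun n : ℕ => dirMax f h (2 ^ n) x := by
  refine monotone_nat_of_le_succ fun n => iSup_le fun j => ?_
  refine le_trans (le_of_eq ?_) (le_iSup _ (j + 1))
  rw [pow_succ, pow_succ, mul_div_mul_right _ _ two_ne_zero]

/-- The strong-type constant does not depend on `R`, so monotone convergence along `R = 2 ^ n`
removes the restriction on the lengths. -/
theorem lintegral_iSup_dirMax_rpow_le (μ : Measure E) [μ.IsAddHaarMeasure] {p : ℝ} (hp : 1 < p)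
    {f : E → ℝ≥0∞} (hf : Measurable f) (h : E) :
    ∫⁻ x, (⨆ n : ℕ, dirMax f h (2 ^ n) x) ^ p ∂μ ≤ 2 * maximalConst p * ∫⁻ x, f x ^ p ∂μ := by
  have hp0 : 0 < p := by linarith
  have h1 : ∀ x, (⨆ n : ℕ, dirMax f h (2 ^ n) x) ^ p = ⨆ n : ℕ, dirMax f h (2 ^ n) x ^ p :=
    fun x => (ENNReal.orderIsoRpow p hp0).map_iSup _
  simp_rw [h1]
  rw [lintegral_iSup (fun n => (measurable_dirMax hf h _).pow_const p)
    (fun m n hmn x => ENNReal.rpow_le_rpow (monotone_dirMax_two_pow f h x hmn) hp0.le)]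
  exact iSup_le fun n => lintegral_dirMax_rpow_le μ hp hf h (by positivity)

/-- Rounding `r` up to a power of two at most doubles it, and every power of two, large or small, is
one of the lengths `2 ^ n / 2 ^ j`. -/
theorem setLIntegral_Ioo_le_iSup_dirMax (f : E → ℝ≥0∞) (h x : E) {r : ℝ} (hr : 0 < r) :
    ∫⁻ τ in Ioo 0 r, f (x + τ • h) ≤ ENNReal.ofReal (2 * r) * ⨆ n : ℕ, dirMax f h (2 ^ n) x := by
  obtain ⟨m, hm1, hm2⟩ := exists_mem_Ioc_zpow hr (one_lt_two (α := ℝ))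
  have e : ∃ n j : ℕ, (2 : ℝ) ^ (m + 1) = 2 ^ n / 2 ^ j := by
    refine ⟨(m + 1).toNat, (-(m + 1)).toNat, ?_⟩
    rw [← zpow_natCast, ← zpow_natCast, ← zpow_sub₀ two_ne_zero]
    congr 1
    omega
  obtain ⟨n, j, hnj⟩ := e
  have hρ : (0 : ℝ) < 2 ^ n / 2 ^ j := by positivity
  have hle : (2 : ℝ) ^ n / 2 ^ j ≤ 2 * r := by
    rw [← hnj, zpow_add_one₀ two_ne_zero]; linarith
  calc ∫⁻ τ in Ioo 0 r, f (x + τ • h)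
      ≤ ∫⁻ τ in Ioo 0 (2 ^ n / 2 ^ j : ℝ), f (x + τ • h) :=
        lintegral_mono_set (Ioo_subset_Ioo_right (hnj ▸ hm2))
    _ = ENNReal.ofReal (2 ^ n / 2 ^ j) * dirAvg f h (2 ^ n / 2 ^ j) x := by
        rw [dirAvg, ← mul_assoc, ENNReal.mul_inv_cancel, one_mul]
        · simpa using hρ
        · exact ENNReal.ofReal_ne_top
    _ ≤ _ := by
        gcongr
        exact (le_iSup (fun j : ℕ => dirAvg f h (2 ^ n / 2 ^ j) x) j).trans
          (le_iSup (fun n : ℕ => dirMax f h (2 ^ n) x) n)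

theorem enorm_sub_le_lintegral_fderiv {v : E → ℝ} (hv : ContDiff ℝ 1 v) (x h : E) {r : ℝ}
    (hr : 0 ≤ r) :
    ‖v (x + r • h) - v x‖ₑ ≤ ‖h‖ₑ * ∫⁻ τ in Ioo 0 r, ‖fderiv ℝ v (x + τ • h)‖ₑ := by
  have hd : ∀ τ ∈ uIcc 0 r, HasDerivAt (fun τ : ℝ => v (x + τ • h)) (fderiv ℝ v (x + τ • h) h) τ := by
    intro τ _
    have h1 : HasDerivAt (fun τ : ℝ => x + τ • h) h τ := by
      simpa using ((hasDerivAt_id τ).smul_const h).const_add x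
    exact ((hv.differentiable one_ne_zero _).hasFDerivAt).comp_hasDerivAt τ h1
  have hc : Continuous fun τ : ℝ => fderiv ℝ v (x + τ • h) h := by
    have := hv.continuous_fderiv one_ne_zero
    fun_prop
  have h2 := intervalIntegral.integral_eq_sub_of_hasDerivAt hd (hc.intervalIntegrable _ _)
  simp only [zero_smul, add_zero] at h2
  rw [← h2, intervalIntegral.integral_of_le hr, integral_Ioc_eq_integral_Ioo]
  refine (enorm_integral_le_lintegral_enorm _).trans ?_
  rw [← lintegral_const_mul' _ _ enorm_ne_top]
  refine lintegral_mono fun τ => ?_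
  rw [mul_comm]
  exact ContinuousLinearMap.le_opENorm _ _

/-- The constant `4` is the bound `‖h‖ ≤ 2` times the loss of 2 from rounding `r` to a dyadic
length. -/
theorem enorm_sub_le_iSup_dirMax {v : E → ℝ} (hv : ContDiff ℝ 1 v) (x : E) {h : E}
    (hh : ‖h‖ ≤ 2) {r : ℝ} (hr : 0 < r) :
    ‖v (x + r • h) - v x‖ₑ ≤
      ENNReal.ofReal (4 * r) * ⨆ n : ℕ, dirMax (fun y => ‖fderiv ℝ v y‖ₑ) h (2 ^ n) x := by
  refine (enorm_sub_le_lintegral_fderiv hv x h hr.le).trans ?_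
  refine (mul_le_mul' (b := ENNReal.ofReal 2) ?_ (setLIntegral_Ioo_le_iSup_dirMax
    (fun y => ‖fderiv ℝ v y‖ₑ) h x hr)).trans
    (le_of_eq ?_)
  · rw [← ofReal_norm]; exact ENNReal.ofReal_le_ofReal hh
  · rw [← mul_assoc, ← ENNReal.ofReal_mul (by norm_num)]
    congr 2; ring

end Upper

/-- Applied to `a = ‖h‖` and `s = 1 + γ / p`, which may have either sign; the absolute value treats
both at once. -/
theorem two_rpow_neg_abs_le {a : ℝ} (h1 : 1 ≤ a) (h2 : a ≤ 2) (s : ℝ) :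
    (2 : ℝ) ^ (-|s|) ≤ a ^ s := by
  have ha : 0 < a := by linarith
  rcases le_total 0 s with hs | hs
  · exact (Real.rpow_le_one_of_one_le_of_nonpos one_le_two (by simp)).trans
      (Real.one_le_rpow h1 hs)
  · rw [abs_of_nonpos hs, neg_neg]
    exact Real.rpow_le_rpow_of_nonpos ha h2 hs

theorem abs_diffQuot_add_smul {N : ℕ} (b : ℝ) (v : EuclideanSpace ℝ (Fin N) → ℝ)
    (x h : EuclideanSpace ℝ (Fin N)) {r : ℝ} (hr : 0 < r) :
    |diffQuot b v (x, x + r • h)| = |v (x + r • h) - v x| / (r ^ (1 + b) * ‖h‖ ^ (1 + b)) := by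
  have : ‖x - (x + r • h)‖ = r * ‖h‖ := by
    rw [sub_add_cancel_left, norm_neg, norm_smul, Real.norm_of_nonneg hr.le]
  rw [diffQuot, this, abs_div, Real.mul_rpow hr.le (norm_nonneg _), abs_sub_comm,
    abs_of_nonneg (a := r ^ (1 + b) * ‖h‖ ^ (1 + b)) (by positivity)]

/-- With `M` the maximal function, the increment is at most `4 r M`. Comparing with the denominator
`r ^ (1 + γ/p) ‖h‖ ^ (1 + γ/p)` cancels one factor `r`, so on the superlevel set `r ^ (γ / p)` stays
below a multiple of `M / t`. -/
theorem lintegral_superlevel_le {N : ℕ} {p γ : ℝ} (hp : 1 < p) (hγ : γ ≠ 0)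
    {v : EuclideanSpace ℝ (Fin N) → ℝ} (hv : ContDiff ℝ 1 v) {t : ℝ} (ht : 0 < t)
    (x : EuclideanSpace ℝ (Fin N)) {h : EuclideanSpace ℝ (Fin N)}
    (hh : h ∈ unitAnnulus (EuclideanSpace ℝ (Fin N))) :
    ∫⁻ r in Ioi (0 : ℝ), {z | t < |diffQuot (γ / p) v z|}.indicator 1 (x, x + r • h) *
      ENNReal.ofReal (r ^ (γ - 1)) ≤
    (ENNReal.ofReal (4 * 2 ^ |1 + γ / p| * t⁻¹) *
      ⨆ n : ℕ, dirMax (fun y => ‖fderiv ℝ v y‖ₑ) h (2 ^ n) x) ^ p * ENNReal.ofReal |γ|⁻¹ := by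
  have hp0 : 0 < p := by linarith
  rw [← lintegral_rpow_sub_one_indicator hp0 hγ]
  refine setLIntegral_mono' measurableSet_Ioi fun r hr => ?_
  have hr : 0 < r := hr
  by_cases hm : (x, x + r • h) ∈ {z | t < |diffQuot (γ / p) v z|}
  swap
  · rw [indicator_of_notMem hm, zero_mul]; exact zero_le
  rw [indicator_of_mem hm, Pi.one_apply, one_mul, indicator_of_mem]
  rw [mem_ofPred_eq] at hm ⊢
  set M := ⨆ n : ℕ, dirMax (fun y => ‖fderiv ℝ v y‖ₑ) h (2 ^ n) x
  have hΔ := enorm_sub_le_iSup_dirMax hv x hh.2.le hr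
  rw [abs_diffQuot_add_smul _ _ _ _ hr] at hm
  have hpos : 0 < ‖h‖ := by linarith [hh.1]
  have h2 := two_rpow_neg_abs_le hh.1.le hh.2.le (1 + γ / p)
  rw [lt_div_iff₀ (by positivity)] at hm
  have hD : 0 < (2 : ℝ) ^ |1 + γ / p| := by positivity
  have h3 : t * (r * r ^ (γ / p) * (2 ^ |1 + γ / p|)⁻¹) < |v (x + r • h) - v x| := by
    refine lt_of_le_of_lt ?_ hm
    rw [Real.rpow_add hr, Real.rpow_one]
    rw [Real.rpow_neg zero_le_two] at h2
    gcongr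
  have h4 : ENNReal.ofReal (t * (r * r ^ (γ / p) * (2 ^ |1 + γ / p|)⁻¹)) <
      ENNReal.ofReal (4 * r) * M := by
    refine lt_of_lt_of_le ?_ hΔ
    rw [← ofReal_norm, Real.norm_eq_abs]
    exact (ENNReal.ofReal_lt_ofReal_iff_of_nonneg (by positivity)).2 h3
  have h5 : ENNReal.ofReal (r ^ (γ / p)) = ENNReal.ofReal (2 ^ |1 + γ / p| * t⁻¹ * r⁻¹) *
      ENNReal.ofReal (t * (r * r ^ (γ / p) * (2 ^ |1 + γ / p|)⁻¹)) := by
    rw [← ENNReal.ofReal_mul (by positivity)]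
    congr 1; field_simp
  have h6 : ENNReal.ofReal (4 * 2 ^ |1 + γ / p| * t⁻¹) * M =
      ENNReal.ofReal (2 ^ |1 + γ / p| * t⁻¹ * r⁻¹) * (ENNReal.ofReal (4 * r) * M) := by
    rw [← mul_assoc, ← ENNReal.ofReal_mul (by positivity)]
    congr 2; field_simp
  rw [h5, h6]
  exact (ENNReal.mul_lt_mul_iff_right (by rw [Ne, ENNReal.ofReal_eq_zero, not_le]; positivity)
    ENNReal.ofReal_ne_top).2 h4

theorem measurableSet_superlevel_diffQuot {N : ℕ} {u : EuclideanSpace ℝ (Fin N) → ℝ}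
    (hu : Measurable u) (b t : ℝ) : MeasurableSet {z | t < |diffQuot b u z|} :=
  measurableSet_lt measurable_const (measurable_diffQuot hu b).abs

/-- The weak-type upper bound for continuously differentiable functions. -/
theorem exists_weakLpNorm_diffQuot_le (N : ℕ) {p γ : ℝ} (hp : 1 < p) (hγ : γ ≠ 0) :
    ∃ C : ℝ≥0, ∀ v : EuclideanSpace ℝ (Fin N) → ℝ, ContDiff ℝ 1 v →
      weakLpNorm (diffQuot (γ / p) v) p (nuMeasure N γ) ≤
        C * eLpNorm (fderiv ℝ v) (ENNReal.ofReal p) volume := by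
  have hp0 : 0 < p := by linarith
  set E := EuclideanSpace ℝ (Fin N)
  set D : ℝ := 4 * 2 ^ |1 + γ / p| with hD
  have hD0 : 0 < D := by positivity
  set c := annulusConst (γ - N)
  have hc0 : c ≠ 0 := annulusConst_ne_zero _
  have hct : c ≠ ⊤ := annulusConst_ne_top _
  set K : ℝ≥0∞ := c⁻¹ * (ENNReal.ofReal D ^ p * ENNReal.ofReal |γ|⁻¹ * (2 * maximalConst p) *
    volume (unitAnnulus E)) with hK
  have hKt : K ≠ ⊤ := by
    refine ENNReal.mul_ne_top (ENNReal.inv_ne_top.2 hc0) (ENNReal.mul_ne_top (ENNReal.mul_ne_top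
      (ENNReal.mul_ne_top ?_ ENNReal.ofReal_ne_top) ?_) (measure_unitAnnulus_lt_top volume).ne)
    · exact ENNReal.rpow_ne_top_of_nonneg hp0.le ENNReal.ofReal_ne_top
    · exact ENNReal.mul_ne_top ENNReal.ofNat_ne_top ENNReal.coe_ne_top
  refine ⟨(K ^ (1 / p)).toNNReal, fun v hv => ?_⟩
  rw [ENNReal.coe_toNNReal (ENNReal.rpow_ne_top_of_nonneg (by positivity) hKt)]
  refine weakLpNorm_le_of_forall hp0 fun t ht => ?_
  rw [ENNReal.mul_rpow_of_nonneg _ _ hp0.le, ← ENNReal.rpow_mul, one_div_mul_cancel hp0.ne',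
    ENNReal.rpow_one, eLpNorm_ofReal_rpow_eq _ hp0]
  have hf : Measurable fun y => ‖fderiv ℝ v y‖ₑ := (measurable_fderiv ℝ v).enorm
  set S := {z | t < |diffQuot (γ / p) v z|}
  have hS : MeasurableSet S := measurableSet_superlevel_diffQuot hv.continuous.measurable _ _
  set I := ∫⁻ x, ‖fderiv ℝ v x‖ₑ ^ p
  -- The ray estimate is integrated in `x` for each fixed `h`; the maximal bound is uniform in `h`,
  -- so the annulus contributes only its volume.
  have h1 : c * nuMeasure N γ S ≤ ENNReal.ofReal (D * t⁻¹) ^ p * ENNReal.ofReal |γ|⁻¹ *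
      (2 * maximalConst p * I) * volume (unitAnnulus E) := by
    rw [annulusConst_mul_nuMeasure N γ hS, ← setLIntegral_const]
    refine setLIntegral_mono' measurableSet_unitAnnulus fun h hh => ?_
    refine (lintegral_mono fun x => lintegral_superlevel_le hp hγ hv ht x hh).trans ?_
    simp_rw [ENNReal.mul_rpow_of_nonneg _ _ hp0.le]
    have hDt : ENNReal.ofReal (D * t⁻¹) ^ p ≠ ⊤ :=
      ENNReal.rpow_ne_top_of_nonneg hp0.le ENNReal.ofReal_ne_top
    rw [lintegral_mul_const' _ _ ENNReal.ofReal_ne_top, lintegral_const_mul' _ _ hDt,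
      mul_right_comm]
    gcongr
    exact lintegral_iSup_dirMax_rpow_le volume hp hf h
  calc ENNReal.ofReal t ^ p * nuMeasure N γ S
      = c⁻¹ * (ENNReal.ofReal t ^ p * (c * nuMeasure N γ S)) := by
        rw [mul_left_comm, ← mul_assoc c⁻¹, ENNReal.inv_mul_cancel hc0 hct, one_mul]
    _ ≤ c⁻¹ * (ENNReal.ofReal t ^ p * (ENNReal.ofReal (D * t⁻¹) ^ p * ENNReal.ofReal |γ|⁻¹ *
      (2 * maximalConst p * I) * volume (unitAnnulus E))) := by gcongr
    _ = c⁻¹ * ((ENNReal.ofReal t ^ p * ENNReal.ofReal (D * t⁻¹) ^ p) * ENNReal.ofReal |γ|⁻¹ *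
      (2 * maximalConst p * I) * volume (unitAnnulus E)) := by ring
    _ = K * I := by
        rw [← ENNReal.mul_rpow_of_nonneg _ _ hp0.le, ← ENNReal.ofReal_mul ht.le,
          show t * (D * t⁻¹) = D by field_simp, hK]
        ring

/-! ### The lower bound for continuously differentiable functions -/

theorem rpow_le_two_rpow_abs {a : ℝ} (h1 : 1 ≤ a) (h2 : a ≤ 2) (s : ℝ) :
    a ^ s ≤ (2 : ℝ) ^ |s| := by
  have h := two_rpow_neg_abs_le h1 h2 (-s)
  rw [abs_neg, Real.rpow_neg zero_le_two, Real.rpow_neg (by linarith)] at h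
  exact (inv_le_inv₀ (by positivity) (Real.rpow_pos_of_pos (by linarith) _)).1 h

/-- The levels along which the lower bound is attained. -/
def lowerLevel (γ : ℝ) (n : ℕ) : ℝ := if 0 < γ then (n : ℝ) + 1 else 1 / ((n : ℝ) + 1)

theorem lowerLevel_pos (γ : ℝ) (n : ℕ) : 0 < lowerLevel γ n := by
  unfold lowerLevel; split_ifs <;> positivity

/-- `|γ|⁻¹`, understood as `∞` for `γ = 0`. -/
def lowerConst (γ : ℝ) : ℝ≥0∞ := if γ = 0 then ⊤ else ENNReal.ofReal |γ|⁻¹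

theorem ofReal_rpow_mul_div_rpow {p b t : ℝ} (hp : 0 < p) (ht : 0 < t) (c : ℝ≥0∞) :
    ENNReal.ofReal t ^ p * (ENNReal.ofReal (b / t) ^ p * c) = c * ENNReal.ofReal b ^ p := by
  rw [← mul_assoc, ← ENNReal.mul_rpow_of_nonneg _ _ hp.le, ← ENNReal.ofReal_mul ht.le,
    mul_div_cancel₀ _ ht.ne', mul_comm]

/-- Only `r < δ` is available, and the levels are chosen so that this loses nothing in the limit.
For `γ > 0` the threshold set eventually lies inside `(0, δ)`. For `γ < 0` the discarded tail has
fixed finite mass, multiplied by a power of the level that tends to zero. For `γ = 0` the set is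
eventually all of `(0, δ)`, where `1 / r` is not integrable. -/
theorem lowerConst_mul_le_liminf {p γ : ℝ} (hp : 0 < p) {b δ : ℝ} (hb : 0 < b) (hδ : 0 < δ) :
    lowerConst γ * ENNReal.ofReal b ^ p ≤ liminf (fun n : ℕ =>
      ENNReal.ofReal (lowerLevel γ n) ^ p * ∫⁻ r in Ioo 0 δ,
        {r : ℝ | ENNReal.ofReal (r ^ (γ / p)) < ENNReal.ofReal (b / lowerLevel γ n)}.indicator
          (fun r => ENNReal.ofReal (r ^ (γ - 1))) r) atTop := by
  rcases lt_trichotomy γ 0 with hγ | hγ | hγ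
  · have hlev : ∀ n, lowerLevel γ n = 1 / ((n : ℝ) + 1) := fun n => if_neg hγ.le.not_gt
    -- Starting the tail at `δ / 2` makes it overlap `(0, δ)`, so that the two open sets cover the
    -- half-line.
    set K := ∫⁻ r in Ioi (δ / 2), ENNReal.ofReal (r ^ (γ - 1)) with hK
    have hKt : K ≠ ⊤ := by
      rw [hK, lintegral_Ioi_rpow_sub_one hγ (by positivity)]; exact ENNReal.ofReal_ne_top
    rw [lowerConst, if_neg hγ.ne]
    have hlim : Tendsto (fun n : ℕ => ENNReal.ofReal |γ|⁻¹ * ENNReal.ofReal b ^ p -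
        ENNReal.ofReal (lowerLevel γ n) ^ p * K) atTop
        (𝓝 (ENNReal.ofReal |γ|⁻¹ * ENNReal.ofReal b ^ p)) := by
      have h1 : Tendsto (fun n : ℕ => ENNReal.ofReal (lowerLevel γ n)) atTop (𝓝 0) := by
        simp_rw [hlev]
        rw [← ENNReal.ofReal_zero]
        exact ENNReal.tendsto_ofReal tendsto_one_div_add_atTop_nhds_zero_nat
      have h2 := ((ENNReal.continuous_rpow_const (y := p)).tendsto 0).comp h1
      rw [ENNReal.zero_rpow_of_pos hp] at h2
      have h3 := ENNReal.Tendsto.mul_const (b := K) h2 (Or.inr hKt)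
      rw [zero_mul] at h3
      have h4 := ENNReal.Tendsto.sub (tendsto_const_nhds
        (x := ENNReal.ofReal |γ|⁻¹ * ENNReal.ofReal b ^ p)) h3 (Or.inr ENNReal.zero_ne_top)
      rwa [tsub_zero] at h4
    rw [← hlim.liminf_eq]
    refine liminf_le_liminf (Eventually.of_forall fun n => ?_)
    have ht := lowerLevel_pos γ n
    rw [tsub_le_iff_right, ← ofReal_rpow_mul_div_rpow hp ht, ← mul_add]
    gcongr
    rw [← lintegral_rpow_sub_one_indicator hp hγ.ne]
    have hsub : Ioi (0 : ℝ) ⊆ Ioo 0 δ ∪ Ioi (δ / 2) := by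
      intro r hr
      rcases lt_or_ge r δ with h | h
      · exact Or.inl ⟨hr, h⟩
      · exact Or.inr (mem_Ioi.2 (by linarith))
    refine (lintegral_mono_set hsub).trans ((lintegral_union_le _ _ _).trans ?_)
    gcongr
    exact lintegral_mono fun r => indicator_le_self _ _ _
  · subst hγ
    have hlev : ∀ n, lowerLevel 0 n = 1 / ((n : ℝ) + 1) := fun n => if_neg (lt_irrefl _)
    have h1 : ∀ᶠ n : ℕ in atTop, lowerLevel 0 n < b := by
      simp_rw [hlev]
      exact tendsto_one_div_add_atTop_nhds_zero_nat.eventually_lt_const hb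
    refine le_trans le_top (le_of_eq ?_)
    symm
    refine Tendsto.liminf_eq (tendsto_const_nhds.congr' ?_)
    filter_upwards [h1] with n hn
    have ht := lowerLevel_pos 0 n
    have h2 : ∫⁻ r in Ioo 0 δ,
        {r : ℝ | ENNReal.ofReal (r ^ (0 / p)) < ENNReal.ofReal (b / lowerLevel 0 n)}.indicator
          (fun r => ENNReal.ofReal (r ^ ((0 : ℝ) - 1))) r = ⊤ := by
      rw [← lintegral_Ioo_zero_inv hδ]
      refine lintegral_congr fun r => ?_
      rw [indicator_of_mem, zero_sub]
      rw [mem_ofPred_eq, zero_div, Real.rpow_zero]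
      exact (ENNReal.ofReal_lt_ofReal_iff (by positivity)).2 ((one_lt_div ht).2 hn)
    rw [h2, ENNReal.mul_top]
    have : 0 < ENNReal.ofReal (lowerLevel 0 n) := ENNReal.ofReal_pos.2 ht
    exact (ENNReal.rpow_pos this ENNReal.ofReal_ne_top).ne'
  · have hlev : ∀ n, lowerLevel γ n = (n : ℝ) + 1 := fun n => if_pos hγ
    rw [lowerConst, if_neg hγ.ne']
    have h0 : Tendsto (fun n : ℕ => b / lowerLevel γ n) atTop (𝓝 0) := by
      simp_rw [hlev]
      have := tendsto_one_div_add_atTop_nhds_zero_nat (𝕜 := ℝ) |>.const_mul b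
      simpa [div_eq_mul_inv] using this
    have h1 : ∀ᶠ n : ℕ in atTop, b / lowerLevel γ n < δ ^ (γ / p) :=
      h0.eventually_lt_const (Real.rpow_pos_of_pos hδ _)
    refine le_of_eq (Tendsto.liminf_eq (tendsto_const_nhds.congr' ?_)).symm
    filter_upwards [h1] with n hn
    have ht := lowerLevel_pos γ n
    rw [← ofReal_rpow_mul_div_rpow hp ht, ← lintegral_rpow_sub_one_indicator hp hγ.ne']
    congr 1
    rw [← lintegral_indicator measurableSet_Ioi, ← lintegral_indicator measurableSet_Ioo]
    refine lintegral_congr fun r => ?_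
    by_cases hr : r ∈ Ioo 0 δ
    · rw [indicator_of_mem hr, indicator_of_mem (mem_Ioi.2 hr.1)]
    · rw [indicator_of_notMem hr]
      by_cases hr0 : 0 < r
      · rw [indicator_of_mem (mem_Ioi.2 hr0), indicator_of_notMem]
        rw [mem_ofPred_eq, ENNReal.ofReal_lt_ofReal_iff (by positivity), not_lt]
        refine hn.le.trans (Real.rpow_le_rpow hδ.le ?_ (by positivity))
        by_contra! h
        exact hr ⟨hr0, h⟩
      · rw [indicator_of_notMem (by simpa using hr0)]

theorem exists_forall_mul_le_abs_sub {E : Type*} [NormedAddCommGroup E] [NormedSpace ℝ E]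
    {v : E → ℝ} {x : E} (hv : DifferentiableAt ℝ v x) {h : E} (hh : fderiv ℝ v x h ≠ 0) :
    ∃ δ : ℝ, 0 < δ ∧ ∀ r ∈ Ioo 0 δ, |fderiv ℝ v x h| / 2 * r ≤ |v (x + r • h) - v x| := by
  have h1 : HasDerivAt (fun τ : ℝ => v (x + τ • h)) (fderiv ℝ v x h) 0 := by
    have h1 : HasDerivAt (fun τ : ℝ => x + τ • h) h 0 := by
      simpa using ((hasDerivAt_id (0 : ℝ)).smul_const h).const_add x
    have h2 : HasFDerivAt v (fderiv ℝ v x) (x + (0 : ℝ) • h) := by simpa using hv.hasFDerivAt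
    exact h2.comp_hasDerivAt 0 h1
  have h2 := h1.tendsto_slope_zero_right.abs
  have h3 : |fderiv ℝ v x h| / 2 < |fderiv ℝ v x h| := half_lt_self (abs_pos.2 hh)
  have h4 := h2.eventually_const_lt h3
  obtain ⟨δ, hδ, hs⟩ := mem_nhdsGT_iff_exists_Ioo_subset.1 h4
  refine ⟨δ, hδ, fun r hr => ?_⟩
  have h5 := hs hr
  simp only [mem_ofPred_eq, zero_add, zero_smul, add_zero, smul_eq_mul, abs_mul, abs_inv,
    abs_of_pos hr.1] at h5
  rw [inv_mul_eq_div, lt_div_iff₀ hr.1] at h5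
  exact h5.le

/-- Near `r = 0` the first-order expansion keeps half of `|∂_h v(x)| r`; the factor `2 ^ (-|1 + γ /
p|)` absorbs `‖h‖ ^ (1 + γ / p)`. The admissible `δ` depends on `x` and `h`, so the bound is a
pointwise liminf, ready for Fatou's lemma. -/
theorem lowerConst_mul_le_liminf_superlevel {N : ℕ} {p γ : ℝ} (hp : 0 < p)
    {v : EuclideanSpace ℝ (Fin N) → ℝ} (hv : ContDiff ℝ 1 v)
    (x : EuclideanSpace ℝ (Fin N)) {h : EuclideanSpace ℝ (Fin N)}
    (hh : h ∈ unitAnnulus (EuclideanSpace ℝ (Fin N))) :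
    lowerConst γ * ENNReal.ofReal (2 ^ (-|1 + γ / p|) / 2) ^ p * ‖fderiv ℝ v x h‖ₑ ^ p ≤
      liminf (fun n : ℕ => ENNReal.ofReal (lowerLevel γ n) ^ p * ∫⁻ r in Ioi (0 : ℝ),
        {z | lowerLevel γ n < |diffQuot (γ / p) v z|}.indicator 1 (x, x + r • h) *
          ENNReal.ofReal (r ^ (γ - 1))) atTop := by
  by_cases ha : fderiv ℝ v x h = 0
  · rw [ha, enorm_zero, ENNReal.zero_rpow_of_pos hp, mul_zero]; exact zero_le
  obtain ⟨δ, hδ, hr⟩ := exists_forall_mul_le_abs_sub (hv.differentiable one_ne_zero x) ha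
  set a := |fderiv ℝ v x h| with ha'
  have ha0 : 0 < a := abs_pos.2 ha
  have hb : 0 < 2 ^ (-|1 + γ / p|) / 2 * a := by positivity
  have e : lowerConst γ * ENNReal.ofReal (2 ^ (-|1 + γ / p|) / 2) ^ p * ‖fderiv ℝ v x h‖ₑ ^ p =
      lowerConst γ * ENNReal.ofReal (2 ^ (-|1 + γ / p|) / 2 * a) ^ p := by
    rw [mul_assoc, ← ENNReal.mul_rpow_of_nonneg _ _ hp.le, ← ofReal_norm, Real.norm_eq_abs,
      ← ENNReal.ofReal_mul (by positivity)]
  rw [e]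
  refine (lowerConst_mul_le_liminf hp hb hδ).trans
    (liminf_le_liminf (Eventually.of_forall fun n => ?_))
  have ht := lowerLevel_pos γ n
  refine mul_le_mul' le_rfl ?_
  refine le_trans ?_ (lintegral_mono_set (t := Ioi 0) (s := Ioo 0 δ) Ioo_subset_Ioi_self)
  refine setLIntegral_mono' (measurableSet_Ioo (a := (0 : ℝ)) (b := δ)) fun r hrδ => ?_
  have hr0 := hrδ.1
  by_cases hm : r ∈ {r : ℝ | ENNReal.ofReal (r ^ (γ / p)) <
      ENNReal.ofReal (2 ^ (-|1 + γ / p|) / 2 * a / lowerLevel γ n)}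
  swap
  · rw [indicator_of_notMem hm]; exact zero_le
  rw [indicator_of_mem hm, indicator_of_mem, Pi.one_apply, one_mul]
  rw [mem_ofPred_eq, ENNReal.ofReal_lt_ofReal_iff (by positivity), lt_div_iff₀ ht] at hm
  rw [mem_ofPred_eq, abs_diffQuot_add_smul _ _ _ _ hr0]
  have hpos : 0 < ‖h‖ := by linarith [hh.1]
  rw [lt_div_iff₀ (by positivity)]
  refine lt_of_lt_of_le ?_ (hr r hrδ)
  have h2 := rpow_le_two_rpow_abs hh.1.le hh.2.le (1 + γ / p)
  have h3 : (2 : ℝ) ^ (-|1 + γ / p|) * 2 ^ |1 + γ / p| = 1 := by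
    rw [← Real.rpow_add two_pos, neg_add_cancel, Real.rpow_zero]
  rw [Real.rpow_add hr0, Real.rpow_one]
  calc lowerLevel γ n * (r * r ^ (γ / p) * ‖h‖ ^ (1 + γ / p))
      ≤ lowerLevel γ n * (r * r ^ (γ / p) * 2 ^ |1 + γ / p|) := by gcongr
    _ = (r ^ (γ / p) * lowerLevel γ n) * (r * 2 ^ |1 + γ / p|) := by ring
    _ < (2 ^ (-|1 + γ / p|) / 2 * a) * (r * 2 ^ |1 + γ / p|) :=
        mul_lt_mul_of_pos_right hm (by positivity)
    _ = (2 ^ (-|1 + γ / p|) * 2 ^ |1 + γ / p|) * (a / 2 * r) := by ring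
    _ = a / 2 * r := by rw [h3, one_mul]

/-- Let `e` have length `3 / 2` and point along the vector representing `L`. The ball of radius `1 /
4` around `e` stays in the annulus, and on it `L h ≥ (3/2 - 1/4) ‖L‖ ≥ ‖L‖`. -/
theorem enorm_rpow_mul_volume_ball_le {E : Type*} [NormedAddCommGroup E] [InnerProductSpace ℝ E]
    [MeasurableSpace E] [BorelSpace E] [FiniteDimensional ℝ E] (μ : Measure E)
    [μ.IsAddHaarMeasure] {p : ℝ} (hp : 0 < p) (L : E →L[ℝ] ℝ) :
    ‖L‖ₑ ^ p * μ (ball 0 (1 / 4)) ≤ ∫⁻ h in unitAnnulus E, ‖L h‖ₑ ^ p ∂μ := by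
  by_cases hL : L = 0
  · have h0 : ‖L‖ₑ = 0 := by rw [← ofReal_norm, hL, norm_zero, ENNReal.ofReal_zero]
    rw [h0, ENNReal.zero_rpow_of_pos hp, zero_mul]; exact zero_le
  set g := (InnerProductSpace.toDual ℝ E).symm L with hg
  have hLg : ∀ h, L h = inner ℝ g h := fun h => by
    rw [hg, InnerProductSpace.toDual_symm_apply]
  have hgn : ‖g‖ = ‖L‖ := LinearIsometryEquiv.norm_map _ _
  have hg0 : 0 < ‖g‖ := by rw [hgn]; exact norm_pos_iff.2 hL
  set e : E := (3 / 2 * ‖g‖⁻¹) • g with he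
  have hen : ‖e‖ = 3 / 2 := by
    rw [he, norm_smul, norm_mul, norm_inv, norm_norm, mul_assoc, inv_mul_cancel₀ hg0.ne']
    norm_num
  have hge : inner ℝ g e = 3 / 2 * ‖g‖ := by
    rw [he, inner_smul_right, real_inner_self_eq_norm_sq]
    field_simp
  have hsub : ball e (1 / 4) ⊆ unitAnnulus E := by
    intro h hh
    rw [mem_ball, dist_eq_norm] at hh
    have h1 := norm_sub_norm_le h e
    have h2 := norm_sub_norm_le e h
    rw [norm_sub_rev] at h2
    exact ⟨by linarith, by linarith⟩
  calc ‖L‖ₑ ^ p * μ (ball 0 (1 / 4)) = ∫⁻ _ in ball e (1 / 4), ‖L‖ₑ ^ p ∂μ := by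
        rw [setLIntegral_const, Measure.addHaar_ball_center μ e]
    _ ≤ ∫⁻ h in ball e (1 / 4), ‖L h‖ₑ ^ p ∂μ := by
        refine setLIntegral_mono' measurableSet_ball fun h hh => ?_
        refine ENNReal.rpow_le_rpow ?_ hp.le
        rw [← ofReal_norm, ← ofReal_norm]
        refine ENNReal.ofReal_le_ofReal ?_
        rw [mem_ball, dist_eq_norm] at hh
        have h1 : L h = inner ℝ g e + inner ℝ g (h - e) := by
          rw [hLg, ← inner_add_right]; simp
        have h2 := abs_le.1 (abs_real_inner_le_norm g (h - e))
        have h3 : ‖g‖ * ‖h - e‖ ≤ ‖g‖ * (1 / 4) := by gcongr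
        rw [Real.norm_eq_abs]
        refine le_trans ?_ (le_abs_self _)
        rw [h1, hge, ← hgn]
        linarith
    _ ≤ _ := lintegral_mono_set hsub

/-- The lower bound for continuously differentiable functions; for `γ = 0` the constant is
infinite. -/
theorem exists_lintegral_fderiv_le_weakLpNorm (N : ℕ) {p : ℝ} (hp : 0 < p) (γ : ℝ) :
    ∃ κ : ℝ≥0∞, κ ≠ 0 ∧ (γ = 0 → κ = ⊤) ∧ ∀ v : EuclideanSpace ℝ (Fin N) → ℝ, ContDiff ℝ 1 v →
      κ * ∫⁻ x, ‖fderiv ℝ v x‖ₑ ^ p ≤ weakLpNorm (diffQuot (γ / p) v) p (nuMeasure N γ) ^ p := by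
  let E := EuclideanSpace ℝ (Fin N)
  set c := annulusConst (γ - N)
  have hc0 : c ≠ 0 := annulusConst_ne_zero _
  have hct : c ≠ ⊤ := annulusConst_ne_top _
  set k := lowerConst γ * ENNReal.ofReal (2 ^ (-|1 + γ / p|) / 2) ^ p with hk
  set w := volume (ball (0 : E) (1 / 4)) with hw
  have hw0 : w ≠ 0 := (measure_ball_pos _ _ (by norm_num)).ne'
  have hd0 : ENNReal.ofReal (2 ^ (-|1 + γ / p|) / 2) ^ p ≠ 0 :=
    (ENNReal.rpow_pos (ENNReal.ofReal_pos.2 (by positivity)) ENNReal.ofReal_ne_top).ne'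
  refine ⟨c⁻¹ * (k * w), ?_, ?_, fun v hv => ?_⟩
  · refine mul_ne_zero (ENNReal.inv_ne_zero.2 hct) (mul_ne_zero (mul_ne_zero ?_ hd0) hw0)
    unfold lowerConst
    split_ifs with h
    · exact ENNReal.top_ne_zero
    · exact (ENNReal.ofReal_pos.2 (inv_pos.2 (abs_pos.2 h))).ne'
  · intro h
    rw [hk, lowerConst, if_pos h, ENNReal.top_mul hd0, ENNReal.top_mul hw0, ENNReal.mul_top]
    exact ENNReal.inv_ne_zero.2 hct
  set W := weakLpNorm (diffQuot (γ / p) v) p (nuMeasure N γ)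
  set S : ℕ → Set (E × E) := fun n => {z | lowerLevel γ n < |diffQuot (γ / p) v z|}
  have hS : ∀ n, MeasurableSet (S n) := fun n =>
    measurableSet_superlevel_diffQuot hv.continuous.measurable _ _
  set G : ℕ → E × E → ℝ≥0∞ := fun n q => ENNReal.ofReal (lowerLevel γ n) ^ p *
    ∫⁻ r in Ioi (0 : ℝ), (S n).indicator 1 (q.2, q.2 + r • q.1) * ENNReal.ofReal (r ^ (γ - 1))
    with hG
  have hGm : ∀ n, Measurable (G n) := by
    intro n
    have h1 : Measurable ((S n).indicator (1 : E × E → ℝ≥0∞)) := measurable_one.indicator (hS n)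
    refine Measurable.const_mul ?_ _
    exact Measurable.lintegral_prod_right' (f := fun q : (E × E) × ℝ =>
      (S n).indicator 1 (q.1.2, q.1.2 + q.2 • q.1.1) * ENNReal.ofReal (q.2 ^ (γ - 1))) (by fun_prop)
  have hGW : ∀ n, ∫⁻ h in unitAnnulus E, ∫⁻ x, G n (h, x) ≤ c * W ^ p := by
    intro n
    have h1 := ofReal_rpow_mul_le_weakLpNorm_rpow (μ := nuMeasure N γ) (diffQuot (γ / p) v) hp
      (lowerLevel_pos γ n)
    have h2 : ∫⁻ h in unitAnnulus E, ∫⁻ x, G n (h, x) =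
        ENNReal.ofReal (lowerLevel γ n) ^ p * (c * nuMeasure N γ (S n)) := by
      have hne : ENNReal.ofReal (lowerLevel γ n) ^ p ≠ ⊤ :=
        ENNReal.rpow_ne_top_of_nonneg hp.le ENNReal.ofReal_ne_top
      rw [annulusConst_mul_nuMeasure N γ (hS n), ← lintegral_const_mul' _ _ hne]
      congr 1 with h
      rw [← lintegral_const_mul' _ _ hne]
    rw [h2, mul_left_comm]
    gcongr
  have hfm : Measurable fun q : E × E => ‖fderiv ℝ v q.2 q.1‖ₑ ^ p := by
    have := hv.continuous_fderiv one_ne_zero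
    have h2 : Continuous fun q : E × E => fderiv ℝ v q.2 q.1 := by fun_prop
    exact h2.measurable.enorm.pow_const p
  -- Directional derivatives averaged over the annulus recover the full gradient; Fatou's lemma is
  -- then applied twice, in `x` and in `h`.
  have key : k * w * ∫⁻ x, ‖fderiv ℝ v x‖ₑ ^ p ≤ c * W ^ p := by
    calc k * w * ∫⁻ x, ‖fderiv ℝ v x‖ₑ ^ p
        = k * ∫⁻ x, ‖fderiv ℝ v x‖ₑ ^ p * w := by
          rw [mul_assoc, lintegral_mul_const _ ((measurable_fderiv ℝ v).enorm.pow_const p),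
            mul_comm w]
      _ ≤ k * ∫⁻ x, ∫⁻ h in unitAnnulus E, ‖fderiv ℝ v x h‖ₑ ^ p := by
          gcongr with x
          exact enorm_rpow_mul_volume_ball_le volume hp _
      _ = k * ∫⁻ h in unitAnnulus E, ∫⁻ x, ‖fderiv ℝ v x h‖ₑ ^ p := by
          congr 1
          exact lintegral_lintegral_swap (hfm.comp measurable_swap).aemeasurable
      _ = ∫⁻ h in unitAnnulus E, ∫⁻ x, k * ‖fderiv ℝ v x h‖ₑ ^ p := by
          rw [← lintegral_const_mul _ hfm.lintegral_prod_right']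
          congr 1 with h
          exact (lintegral_const_mul k
            (hfm.comp (measurable_const (a := h).prodMk measurable_id))).symm
      _ ≤ ∫⁻ h in unitAnnulus E, ∫⁻ x, liminf (fun n => G n (h, x)) atTop := by
          refine setLIntegral_mono' measurableSet_unitAnnulus fun h hh => ?_
          exact lintegral_mono fun x => lowerConst_mul_le_liminf_superlevel hp hv x hh
      _ ≤ ∫⁻ h in unitAnnulus E, liminf (fun n => ∫⁻ x, G n (h, x)) atTop := by
          refine lintegral_mono fun h => lintegral_liminf_le fun n => ?_
          exact (hGm n).comp (measurable_const.prodMk measurable_id)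
      _ ≤ liminf (fun n => ∫⁻ h in unitAnnulus E, ∫⁻ x, G n (h, x)) atTop :=
          lintegral_liminf_le fun n => (hGm n).lintegral_prod_right'
      _ ≤ c * W ^ p := by
          refine liminf_le_of_frequently_le' (Frequently.of_forall fun n => hGW n)
  calc c⁻¹ * (k * w) * ∫⁻ x, ‖fderiv ℝ v x‖ₑ ^ p
      = c⁻¹ * (k * w * ∫⁻ x, ‖fderiv ℝ v x‖ₑ ^ p) := by ring
    _ ≤ c⁻¹ * (c * W ^ p) := by gcongr
    _ = W ^ p := by rw [← mul_assoc, ENNReal.inv_mul_cancel hc0 hct, one_mul]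

/-! ### Averages of translates in weak `L^p` -/

/-- Layer cake for `|F|` cut off below `τ`: levels under `τ` each see at most `{|F| > τ}`, and above
`τ` the decay `r ^ (-p)` is integrable since `p > 1`. The two contributions are the summands `1` and
`(p - 1)⁻¹`. -/
theorem lintegral_superlevel_indicator_le {α : Type*} [MeasurableSpace α] {μ : Measure α} {p : ℝ}
    (hp : 1 < p) {F : α → ℝ} (hF : Measurable F) {τ : ℝ} (hτ : 0 < τ) :
    ∫⁻ z, {z | τ < |F z|}.indicator (fun z => ‖F z‖ₑ) z ∂μ ≤
      weakLpNorm F p μ ^ p * ENNReal.ofReal (τ ^ (1 - p) * (1 + (p - 1)⁻¹)) := by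
  have hp0 : 0 < p := by linarith
  have hp1 : 0 < p - 1 := by linarith
  have hS : MeasurableSet {z | τ < |F z|} := measurableSet_lt measurable_const hF.abs
  set W := weakLpNorm F p μ
  have hle : ∀ r : ℝ, 0 < r → μ {z | r < |F z|} ≤ W ^ p * ENNReal.ofReal (r ^ (-p)) := by
    intro r hr
    have h1 := ofReal_rpow_mul_le_weakLpNorm_rpow (μ := μ) F hp0 hr
    have h2 : ENNReal.ofReal (r ^ (-p)) * ENNReal.ofReal r ^ p = 1 := by
      rw [ENNReal.ofReal_rpow_of_pos hr, ← ENNReal.ofReal_mul (by positivity), ← Real.rpow_add hr,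
        neg_add_cancel, Real.rpow_zero, ENNReal.ofReal_one]
    calc μ {z | r < |F z|} = ENNReal.ofReal (r ^ (-p)) * (ENNReal.ofReal r ^ p *
          μ {z | r < |F z|}) := by rw [← mul_assoc, h2, one_mul]
      _ ≤ ENNReal.ofReal (r ^ (-p)) * W ^ p := by gcongr
      _ = _ := mul_comm _ _
  set f : α → ℝ := {z | τ < |F z|}.indicator fun z => |F z| with hf
  have e : ∀ z, {z | τ < |F z|}.indicator (fun z => ‖F z‖ₑ) z = ENNReal.ofReal (f z) := by
    intro z
    by_cases hz : z ∈ {z | τ < |F z|}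
    · rw [hf, indicator_of_mem hz, indicator_of_mem hz, ← ofReal_norm, Real.norm_eq_abs]
    · rw [hf, indicator_of_notMem hz, indicator_of_notMem hz, ENNReal.ofReal_zero]
  simp_rw [e]
  rw [lintegral_eq_lintegral_meas_lt μ
    (Eventually.of_forall fun z => indicator_nonneg (fun z _ => abs_nonneg _) z)
    (hF.abs.indicator hS).aemeasurable, ← Ioc_union_Ioi_eq_Ioi hτ.le]
  refine (lintegral_union_le _ _ _).trans ?_
  have h1 : ∫⁻ r in Ioc 0 τ, μ {z | r < f z} ≤ W ^ p * ENNReal.ofReal (τ ^ (1 - p)) := by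
    calc ∫⁻ r in Ioc 0 τ, μ {z | r < f z} ≤ ∫⁻ r in Ioc 0 τ, W ^ p * ENNReal.ofReal (τ ^ (-p)) := by
          refine setLIntegral_mono' (measurableSet_Ioc (a := (0 : ℝ)) (b := τ)) fun r hr => ?_
          refine le_trans (measure_mono fun z hz => ?_) (hle τ hτ)
          by_contra h
          have h0 : f z = 0 := indicator_of_notMem h _
          rw [mem_ofPred_eq, h0] at hz
          exact hz.not_ge hr.1.le
      _ = _ := by
          rw [setLIntegral_const, Real.volume_Ioc, sub_zero, mul_assoc,
            ← ENNReal.ofReal_mul (by positivity), sub_eq_neg_add, Real.rpow_add_one hτ.ne']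
  have h2 : ∫⁻ r in Ioi τ, μ {z | r < f z} ≤
      W ^ p * ENNReal.ofReal (τ ^ (1 - p) * (p - 1)⁻¹) := by
    have h3 := lintegral_Ioi_rpow_sub_one (γ := 1 - p) (by linarith) hτ
    rw [show 1 - p - 1 = -p by ring, abs_of_neg (by linarith : 1 - p < 0), neg_sub,
      div_eq_mul_inv] at h3
    rw [← h3, ← lintegral_const_mul _ (by fun_prop)]
    refine setLIntegral_mono' (measurableSet_Ioi (a := τ)) fun r hr => ?_
    refine le_trans (measure_mono fun z hz => ?_) (hle r (hτ.trans hr))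
    exact lt_of_lt_of_le (show r < f z from hz) (indicator_le_self' (fun _ _ => abs_nonneg _) z)
  refine (add_le_add h1 h2).trans (le_of_eq ?_)
  rw [← mul_add, ← ENNReal.ofReal_add (by positivity) (by positivity)]
  congr 2; ring

/-- Both the density and the diagonal depend only on `z.1 - z.2`, and Lebesgue measure is
translation invariant. -/
theorem lintegral_nuMeasure_sub_diag (N : ℕ) (γ : ℝ)
    {H : EuclideanSpace ℝ (Fin N) × EuclideanSpace ℝ (Fin N) → ℝ≥0∞} (hH : Measurable H)
    (s : EuclideanSpace ℝ (Fin N)) :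
    ∫⁻ z, H (z - (s, s)) ∂(nuMeasure N γ) = ∫⁻ z, H z ∂(nuMeasure N γ) := by
  have hD : MeasurableSet {z : EuclideanSpace ℝ (Fin N) × EuclideanSpace ℝ (Fin N) | z.1 ≠ z.2} :=
    (measurableSet_eq_fun measurable_fst measurable_snd).compl
  have hw : Measurable fun z : EuclideanSpace ℝ (Fin N) × EuclideanSpace ℝ (Fin N) =>
      ENNReal.ofReal (‖z.1 - z.2‖ ^ (γ - (N : ℝ))) := by fun_prop
  rw [nuMeasure, lintegral_withDensity_eq_lintegral_mul _ hw (by fun_prop),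
    lintegral_withDensity_eq_lintegral_mul _ hw hH, ← lintegral_indicator hD,
    ← lintegral_indicator hD, Measure.volume_eq_prod]
  conv_rhs => rw [← lintegral_sub_right_eq_self ({z : EuclideanSpace ℝ (Fin N) × EuclideanSpace ℝ (Fin N) |
    z.1 ≠ z.2}.indicator _) (s, s)]
  congr 1 with z
  simp only [indicator, mem_ofPred_eq, Pi.mul_apply, Prod.fst_sub, Prod.snd_sub, Ne, sub_left_inj,
    sub_sub_sub_cancel_right]

/-! ### Mollification -/

section Mollify

variable {N : ℕ} {F : Type*} [NormedAddCommGroup F] [NormedSpace ℝ F]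

/-- The convolution with the normalized bump function `φ`. -/
def mollify (φ : ContDiffBump (0 : EuclideanSpace ℝ (Fin N)))
    (u : EuclideanSpace ℝ (Fin N) → F) : EuclideanSpace ℝ (Fin N) → F :=
  φ.normed volume ⋆[ContinuousLinearMap.lsmul ℝ ℝ, volume] u

variable (φ : ContDiffBump (0 : EuclideanSpace ℝ (Fin N)))

theorem mollify_apply (u : EuclideanSpace ℝ (Fin N) → F) (x : EuclideanSpace ℝ (Fin N)) :
    mollify φ u x = ∫ s, φ.normed volume s • u (x - s) := rfl

theorem integrable_mollify {u : EuclideanSpace ℝ (Fin N) → F} (hu : LocallyIntegrable u)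
    (x : EuclideanSpace ℝ (Fin N)) : Integrable fun s => φ.normed volume s • u (x - s) :=
  φ.hasCompactSupport_normed.convolutionExists_left (ContinuousLinearMap.lsmul ℝ ℝ)
    φ.continuous_normed hu x

theorem contDiff_mollify [CompleteSpace F] {u : EuclideanSpace ℝ (Fin N) → F}
    (hu : LocallyIntegrable u) {n : ℕ∞} : ContDiff ℝ n (mollify φ u) :=
  φ.hasCompactSupport_normed.contDiff_convolution_left _ φ.contDiff_normed hu

theorem mollify_congr_ae {u v : EuclideanSpace ℝ (Fin N) → F} (h : u =ᵐ[volume] v) :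
    mollify φ u = mollify φ v := by
  ext x
  rw [mollify_apply, mollify_apply]
  refine integral_congr_ae ?_
  filter_upwards [(quasiMeasurePreserving_sub_left volume x).ae_eq_comp h] with s hs
  exact congrArg _ hs

theorem lintegral_normed_eq_one : ∫⁻ s, ENNReal.ofReal (φ.normed volume s) = 1 := by
  rw [← ofReal_integral_eq_lintegral_ofReal φ.integrable_normed
    (Eventually.of_forall φ.nonneg_normed), φ.integral_normed, ENNReal.ofReal_one]

theorem measurable_ofReal_normed : Measurable fun s => ENNReal.ofReal (φ.normed volume s) :=
  φ.continuous_normed.measurable.ennreal_ofReal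

/-- Translating both points by the same `s` leaves the denominator unchanged, so it passes under the
integral. -/
theorem diffQuot_mollify {u : EuclideanSpace ℝ (Fin N) → ℝ} (hu : LocallyIntegrable u) (b : ℝ)
    (z : EuclideanSpace ℝ (Fin N) × EuclideanSpace ℝ (Fin N)) :
    diffQuot b (mollify φ u) z = ∫ s, φ.normed volume s * diffQuot b u (z - (s, s)) := by
  rw [diffQuot, mollify_apply, mollify_apply,
    ← integral_sub (integrable_mollify φ hu _) (integrable_mollify φ hu _), ← integral_div]
  congr 1 with s
  simp only [diffQuot, Prod.fst_sub, Prod.snd_sub, sub_sub_sub_cancel_right, smul_eq_mul]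
  ring

/-- The part of the quotient bounded by `t / 2` averages to at most `t / 2`. The excess is
integrable, averaging preserves its integral by diagonal invariance, and Markov's inequality at `t /
2` concludes. The constant is independent of `φ`, as the limit of shrinking bumps requires. -/
theorem exists_weakLpNorm_diffQuot_mollify_le (N : ℕ) {p : ℝ} (hp : 1 < p) (γ b : ℝ) :
    ∃ C : ℝ≥0, ∀ u : EuclideanSpace ℝ (Fin N) → ℝ, Measurable u → LocallyIntegrable u →
      ∀ φ : ContDiffBump (0 : EuclideanSpace ℝ (Fin N)),
        weakLpNorm (diffQuot b (mollify φ u)) p (nuMeasure N γ) ≤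
          C * weakLpNorm (diffQuot b u) p (nuMeasure N γ) := by
  have hp0 : 0 < p := by linarith
  have hp1 : 0 < p - 1 := by linarith
  set K : ℝ := 2 ^ p * (1 + (p - 1)⁻¹) with hK
  have hK0 : 0 < K := by positivity
  refine ⟨(K ^ (1 / p)).toNNReal, fun u hum hu φ => ?_⟩
  refine weakLpNorm_le_of_forall hp0 fun t ht => ?_
  set W := weakLpNorm (diffQuot b u) p (nuMeasure N γ)
  have hC : (((K ^ (1 / p)).toNNReal : ℝ≥0∞) * W) ^ p = ENNReal.ofReal K * W ^ p := by
    rw [ENNReal.mul_rpow_of_nonneg _ _ hp0.le]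
    congr 1
    change ENNReal.ofReal (K ^ (1 / p)) ^ p = _
    rw [ENNReal.ofReal_rpow_of_pos (by positivity), ← Real.rpow_mul hK0.le,
      one_div_mul_cancel hp0.ne', Real.rpow_one]
  rw [hC]
  have hQ := measurable_diffQuot hum b
  have hτ : 0 < t / 2 := half_pos ht
  set k : EuclideanSpace ℝ (Fin N) → ℝ≥0∞ := fun s => ENNReal.ofReal (φ.normed volume s) with hk
  have hkm : Measurable k := measurable_ofReal_normed φ
  set H := {z | t / 2 < |diffQuot b u z|}.indicator fun z => ‖diffQuot b u z‖ₑ with hH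
  have hHm : Measurable H := hQ.enorm.indicator (measurableSet_superlevel_diffQuot hum b _)
  have hle : ∀ z, ‖diffQuot b u z‖ₑ ≤ ENNReal.ofReal (t / 2) + H z := by
    intro z
    by_cases hz : z ∈ {z | t / 2 < |diffQuot b u z|}
    · rw [hH, indicator_of_mem hz]; exact le_add_self
    · rw [hH, indicator_of_notMem hz, add_zero, ← ofReal_norm]
      exact ENNReal.ofReal_le_ofReal (not_lt.1 hz)
  have hsub : {z | t < |diffQuot b (mollify φ u) z|} ⊆
      {z | ENNReal.ofReal (t / 2) ≤ ∫⁻ s, k s * H (z - (s, s))} := by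
    intro z hz
    have h1 : ENNReal.ofReal t < ‖diffQuot b (mollify φ u) z‖ₑ := by
      rw [← ofReal_norm]
      exact (ENNReal.ofReal_lt_ofReal_iff_of_nonneg ht.le).2 hz
    have h2 : ‖diffQuot b (mollify φ u) z‖ₑ ≤
        ENNReal.ofReal (t / 2) + ∫⁻ s, k s * H (z - (s, s)) := by
      rw [diffQuot_mollify φ hu]
      refine (enorm_integral_le_lintegral_enorm _).trans ?_
      calc ∫⁻ s, ‖φ.normed volume s * diffQuot b u (z - (s, s))‖ₑ
          ≤ ∫⁻ s, (k s * ENNReal.ofReal (t / 2) + k s * H (z - (s, s))) := by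
            refine lintegral_mono fun s => ?_
            rw [enorm_mul, ← mul_add, ← ofReal_norm (φ.normed volume s),
              Real.norm_of_nonneg (φ.nonneg_normed s)]
            gcongr
            exact hle _
        _ = _ := by
            rw [lintegral_add_left (by fun_prop), lintegral_mul_const _ hkm,
              lintegral_normed_eq_one, one_mul]
    have h3 := h1.trans_le h2
    rw [show ENNReal.ofReal t = ENNReal.ofReal (t / 2) + ENNReal.ofReal (t / 2) by
      rw [← ENNReal.ofReal_add hτ.le hτ.le, add_halves]] at h3
    exact (lt_of_add_lt_add_left h3).le
  have hjm : Measurable fun q : (EuclideanSpace ℝ (Fin N) × EuclideanSpace ℝ (Fin N)) ×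
      EuclideanSpace ℝ (Fin N) => k q.2 * H (q.1 - (q.2, q.2)) := by fun_prop
  have : SigmaFinite (nuMeasure N γ) := by
    unfold nuMeasure
    exact SigmaFinite.withDensity_ofReal _
  have hint : ∫⁻ z, ∫⁻ s, k s * H (z - (s, s)) ∂volume ∂(nuMeasure N γ) = ∫⁻ z, H z ∂(nuMeasure N γ) := by
    rw [lintegral_lintegral_swap hjm.aemeasurable]
    have : ∀ s, ∫⁻ z, k s * H (z - (s, s)) ∂(nuMeasure N γ) =
        k s * ∫⁻ z, H z ∂(nuMeasure N γ) := by
      intro s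
      rw [lintegral_const_mul _ (by fun_prop), lintegral_nuMeasure_sub_diag N γ hHm]
    simp_rw [this]
    rw [lintegral_mul_const _ hkm, lintegral_normed_eq_one, one_mul]
  have hmarkov := mul_meas_ge_le_lintegral₀ (μ := nuMeasure N γ)
    (hjm.lintegral_prod_right' (ν := volume)).aemeasurable (ENNReal.ofReal (t / 2))
  rw [hint] at hmarkov
  have hfin := hmarkov.trans (lintegral_superlevel_indicator_le hp hQ hτ)
  calc ENNReal.ofReal t ^ p * nuMeasure N γ {z | t < |diffQuot b (mollify φ u) z|}
      = ENNReal.ofReal (2 * t ^ (p - 1)) * (ENNReal.ofReal (t / 2) *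
          nuMeasure N γ {z | t < |diffQuot b (mollify φ u) z|}) := by
        rw [← mul_assoc, ← ENNReal.ofReal_mul (by positivity), ENNReal.ofReal_rpow_of_pos ht,
          Real.rpow_sub_one ht.ne']
        congr 2; field_simp
    _ ≤ ENNReal.ofReal (2 * t ^ (p - 1)) * (W ^ p *
          ENNReal.ofReal ((t / 2) ^ (1 - p) * (1 + (p - 1)⁻¹))) := by
        refine mul_le_mul' le_rfl (le_trans ?_ hfin)
        exact mul_le_mul' le_rfl (measure_mono hsub)
    _ = ENNReal.ofReal K * W ^ p := by
        rw [mul_left_comm, mul_comm, ← ENNReal.ofReal_mul (by positivity)]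
        congr 2
        rw [hK, Real.div_rpow ht.le zero_le_two, show p - 1 = -(1 - p) by ring,
          Real.rpow_neg ht.le, show (2 : ℝ) ^ p = 2 * 2 ^ (-(1 - p)) by
            rw [neg_sub, Real.rpow_sub_one two_ne_zero]; field_simp, Real.rpow_neg zero_le_two]
        have : t ^ (1 - p) ≠ 0 := (Real.rpow_pos_of_pos ht _).ne'
        have : (2 : ℝ) ^ (1 - p) ≠ 0 := (Real.rpow_pos_of_pos two_pos _).ne'
        field_simp

end Mollify

/-! ### Mollification and gradients -/

section MollifyGradient

variable {N : ℕ} (φ : ContDiffBump (0 : EuclideanSpace ℝ (Fin N)))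

theorem enorm_gradient_eq (v : EuclideanSpace ℝ (Fin N) → ℝ) (x : EuclideanSpace ℝ (Fin N)) :
    ‖gradient v x‖ₑ = ‖fderiv ℝ v x‖ₑ := by
  rw [← ofReal_norm, ← ofReal_norm, gradient, LinearIsometryEquiv.norm_map]

theorem eLpNorm_gradient_eq (v : EuclideanSpace ℝ (Fin N) → ℝ) (p : ℝ≥0∞) :
    eLpNorm (gradient v) p volume = eLpNorm (fderiv ℝ v) p volume :=
  eLpNorm_congr_enorm_ae (Eventually.of_forall (enorm_gradient_eq v))

theorem gradient_apply_eq (v : EuclideanSpace ℝ (Fin N) → ℝ) (x : EuclideanSpace ℝ (Fin N))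
    (i : Fin N) : gradient v x i = fderiv ℝ v x (EuclideanSpace.single i 1) := by
  have h : inner ℝ (gradient v x) (EuclideanSpace.single i (1 : ℝ)) =
      fderiv ℝ v x (EuclideanSpace.single i 1) := by
    rw [gradient, InnerProductSpace.toDual_symm_apply]
  rw [← h, EuclideanSpace.inner_single_right]
  simp

/-- The derivative falls on the kernel, and `y ↦ k (x - y)` is an admissible test function in the
definition of the weak gradient; the sign from the reflection cancels the one from integration by
parts. -/
theorem gradient_mollify {u : EuclideanSpace ℝ (Fin N) → ℝ}
    {g : EuclideanSpace ℝ (Fin N) → EuclideanSpace ℝ (Fin N)} (hu : LocallyIntegrable u)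
    (hg : HasWeakGradient u g) : gradient (mollify φ u) = mollify φ g := by
  ext x i
  rw [gradient_apply_eq]
  set k := φ.normed (volume : Measure (EuclideanSpace ℝ (Fin N))) with hk
  have hkd : ContDiff ℝ ∞ k := φ.contDiff_normed
  have hkc : HasCompactSupport k := φ.hasCompactSupport_normed
  have hd := hkc.hasFDerivAt_convolution_left (ContinuousLinearMap.lsmul ℝ ℝ)
    (hkd.of_le (by simp)) hu x
  have hex : Integrable fun s => (ContinuousLinearMap.precompL (EuclideanSpace ℝ (Fin N))
      (ContinuousLinearMap.lsmul ℝ ℝ : ℝ →L[ℝ] ℝ →L[ℝ] ℝ)) (fderiv ℝ k s) (u (x - s)) :=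
    (hkc.fderiv ℝ).convolutionExists_left _ (hkd.continuous_fderiv (by simp)) hu x
  have h1 : fderiv ℝ (mollify φ u) x (EuclideanSpace.single i 1) =
      ∫ s, fderiv ℝ k s (EuclideanSpace.single i 1) * u (x - s) := by
    rw [mollify, hd.fderiv, convolution_def, ContinuousLinearMap.integral_apply hex]
    rfl
  have hψd : ContDiff ℝ ∞ fun y => k (x - y) := hkd.comp (contDiff_const.sub contDiff_id)
  have hψc : HasCompactSupport fun y => k (x - y) :=
    hkc.comp_homeomorph (Homeomorph.subLeft x)
  have hψ : ∀ y, fderiv ℝ (fun y => k (x - y)) y (EuclideanSpace.single i 1) =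
      - fderiv ℝ k (x - y) (EuclideanSpace.single i 1) := by
    intro y
    have h2 : HasFDerivAt (fun y => x - y) (-ContinuousLinearMap.id ℝ (EuclideanSpace ℝ (Fin N))) y :=
      (hasFDerivAt_id y).const_sub x
    have h3 := ((hkd.differentiable (by simp) (x - y)).hasFDerivAt).comp y h2
    rw [show (fun y => k (x - y)) = k ∘ fun y => x - y from rfl, h3.fderiv]
    simp
  have hw := hg.integral_eq _ hψd hψc i
  rw [h1]
  have h4 : ∫ s, fderiv ℝ k s (EuclideanSpace.single i 1) * u (x - s) =
      ∫ y, fderiv ℝ k (x - y) (EuclideanSpace.single i 1) * u y := by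
    rw [← integral_sub_left_eq_self _ volume x]
    simp
  have h5 : ∫ y, fderiv ℝ k (x - y) (EuclideanSpace.single i 1) * u y = ∫ y, g y i * k (x - y) := by
    rw [← neg_inj, ← hw, ← integral_neg]
    congr 1 with y
    rw [hψ]; ring
  rw [h4, h5]
  have h6 : mollify φ g x i = ∫ s, k s * g (x - s) i := by
    rw [mollify_apply]
    have := (EuclideanSpace.proj (𝕜 := ℝ) i).integral_comp_comm (integrable_mollify φ hg.1 x)
    exact this.symm
  rw [h6, ← integral_sub_left_eq_self _ volume x]
  congr 1 with y
  simp [mul_comm]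

/-- Jensen's inequality for the probability measure with density `φ.normed`, in the form of
monotonicity of `L^p` norms, followed by Tonelli and translation invariance. -/
theorem lintegral_enorm_mollify_rpow_le {F : Type*} [NormedAddCommGroup F] [NormedSpace ℝ F]
    {g : EuclideanSpace ℝ (Fin N) → F} (hg : AEStronglyMeasurable g volume) {p : ℝ} (hp : 1 ≤ p) :
    ∫⁻ x, ‖mollify φ g x‖ₑ ^ p ≤ ∫⁻ x, ‖g x‖ₑ ^ p := by
  have hp0 : 0 < p := by linarith
  set k : EuclideanSpace ℝ (Fin N) → ℝ≥0∞ := fun s => ENNReal.ofReal (φ.normed volume s) with hk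
  have hkm : Measurable k := measurable_ofReal_normed φ
  have hgx : ∀ x, AEMeasurable (fun s => ‖g (x - s)‖ₑ) volume := fun x =>
    (hg.comp_quasiMeasurePreserving (quasiMeasurePreserving_sub_left volume x)).enorm
  have hP : IsProbabilityMeasure (volume.withDensity k) :=
    ⟨by rw [withDensity_apply _ MeasurableSet.univ, Measure.restrict_univ, lintegral_normed_eq_one]⟩
  have hac : volume.withDensity k ≪ volume := withDensity_absolutelyContinuous _ _
  have hjen : ∀ x, ‖mollify φ g x‖ₑ ^ p ≤ ∫⁻ s, k s * ‖g (x - s)‖ₑ ^ p := by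
    intro x
    have h1 : ‖mollify φ g x‖ₑ ≤ ∫⁻ s, ‖g (x - s)‖ₑ ∂(volume.withDensity k) := by
      rw [lintegral_withDensity_eq_lintegral_mul₀ hkm.aemeasurable (hgx x)]
      refine (enorm_integral_le_lintegral_enorm _).trans (le_of_eq ?_)
      congr 1 with s
      rw [ContinuousLinearMap.lsmul_apply, enorm_smul, ← ofReal_norm (φ.normed volume s), Real.norm_of_nonneg (φ.nonneg_normed s)]
      rfl
    have h2 := eLpNorm'_le_eLpNorm'_of_exponent_le zero_lt_one hp (volume.withDensity k)
      (f := fun s => g (x - s))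
      ((hg.comp_quasiMeasurePreserving (quasiMeasurePreserving_sub_left volume x)).mono_ac hac)
    simp only [eLpNorm', ENNReal.rpow_one, one_div, inv_one] at h2
    refine (ENNReal.rpow_le_rpow (h1.trans h2) hp0.le).trans (le_of_eq ?_)
    rw [← ENNReal.rpow_mul, inv_mul_cancel₀ hp0.ne', ENNReal.rpow_one,
      lintegral_withDensity_eq_lintegral_mul₀ hkm.aemeasurable ((hgx x).pow_const p)]
    rfl
  have hjm : AEMeasurable (fun q : EuclideanSpace ℝ (Fin N) × EuclideanSpace ℝ (Fin N) =>
      k q.2 * ‖g (q.1 - q.2)‖ₑ ^ p) (volume.prod volume) := by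
    refine (hkm.comp measurable_snd).aemeasurable.mul (AEMeasurable.pow_const ?_ p)
    exact (hg.comp_quasiMeasurePreserving
      (quasiMeasurePreserving_sub_of_right_invariant volume volume)).enorm
  calc ∫⁻ x, ‖mollify φ g x‖ₑ ^ p ≤ ∫⁻ x, ∫⁻ s, k s * ‖g (x - s)‖ₑ ^ p := lintegral_mono hjen
    _ = ∫⁻ s, ∫⁻ x, k s * ‖g (x - s)‖ₑ ^ p := lintegral_lintegral_swap hjm
    _ = ∫⁻ s, k s * ∫⁻ x, ‖g x‖ₑ ^ p := by
        congr 1 with s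
        rw [lintegral_const_mul' _ _ ENNReal.ofReal_ne_top,
          lintegral_sub_right_eq_self (fun x => ‖g x‖ₑ ^ p) s]
    _ = _ := by rw [lintegral_mul_const _ hkm, lintegral_normed_eq_one, one_mul]

theorem eLpNorm_mollify_le {F : Type*} [NormedAddCommGroup F] [NormedSpace ℝ F]
    {g : EuclideanSpace ℝ (Fin N) → F} (hg : AEStronglyMeasurable g volume) {p : ℝ} (hp : 1 ≤ p) :
    eLpNorm (mollify φ g) (ENNReal.ofReal p) volume ≤ eLpNorm g (ENNReal.ofReal p) volume := by
  have hp0 : 0 < p := by linarith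
  rw [← ENNReal.rpow_le_rpow_iff hp0, eLpNorm_ofReal_rpow_eq _ hp0, eLpNorm_ofReal_rpow_eq _ hp0]
  exact lintegral_enorm_mollify_rpow_le φ hg hp

/-- A sequence of bump functions concentrating at the origin. -/
def shrinkingBump (N : ℕ) (n : ℕ) : ContDiffBump (0 : EuclideanSpace ℝ (Fin N)) where
  rIn := 1 / ((n : ℝ) + 1)
  rOut := 2 * (1 / ((n : ℝ) + 1))
  rIn_pos := by positivity
  rIn_lt_rOut := by
    have : 0 < 1 / ((n : ℝ) + 1) := by positivity
    linarith

theorem tendsto_shrinkingBump_rOut (N : ℕ) :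
    Tendsto (fun n => (shrinkingBump N n).rOut) atTop (𝓝 0) := by
  have := (tendsto_one_div_add_atTop_nhds_zero_nat (𝕜 := ℝ)).const_mul 2
  rwa [mul_zero] at this

theorem ae_tendsto_mollify {F : Type*} [NormedAddCommGroup F] [NormedSpace ℝ F] [CompleteSpace F]
    {g : EuclideanSpace ℝ (Fin N) → F} (hg : LocallyIntegrable g) :
    ∀ᵐ x, Tendsto (fun n => mollify (shrinkingBump N n) g x) atTop (𝓝 (g x)) :=
  -- `K = 2` is the ratio `rOut / rIn` of the chosen bumps; bounded eccentricity allows Lebesgue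
  -- differentiation.
  ContDiffBump.ae_convolution_tendsto_right_of_locallyIntegrable (K := 2)
    (tendsto_shrinkingBump_rOut N) (Eventually.of_forall fun _ => le_rfl) hg

/-- The pairing with `χ` is convolution with its reflection, evaluated at `0`. Associativity applies
the mollifier to the continuous function `u ⋆ κ`, where mollification converges at every point. -/
theorem tendsto_integral_mollify_mul {u χ : EuclideanSpace ℝ (Fin N) → ℝ}
    (hu : LocallyIntegrable u) (hχ : Continuous χ) (hχc : HasCompactSupport χ) :
    Tendsto (fun n => ∫ x, mollify (shrinkingBump N n) u x * χ x) atTop (𝓝 (∫ x, u x * χ x)) := by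
  set κ : EuclideanSpace ℝ (Fin N) → ℝ := fun x => χ (-x) with hκ
  have hκ1 : Continuous κ := hχ.comp continuous_neg
  have hκ2 : HasCompactSupport κ := hχc.comp_homeomorph (Homeomorph.neg _)
  have hun : LocallyIntegrable (fun x => ‖u x‖) := fun x =>
    let ⟨s, hs, hi⟩ := hu x
    ⟨s, hs, hi.norm⟩
  set w := u ⋆[ContinuousLinearMap.lsmul ℝ ℝ, volume] κ with hw
  have hwc : Continuous w := hκ2.continuous_convolution_right _ hu hκ1
  have e1 : ∀ v : EuclideanSpace ℝ (Fin N) → ℝ,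
      (v ⋆[ContinuousLinearMap.lsmul ℝ ℝ, volume] κ) 0 = ∫ x, v x * χ x := by
    intro v
    rw [convolution_def]
    simp [hκ]
  have e2 : ∀ n, ∫ x, mollify (shrinkingBump N n) u x * χ x = mollify (shrinkingBump N n) w 0 := by
    intro n
    rw [← e1, mollify, mollify, hw]
    set k := (shrinkingBump N n).normed (volume : Measure (EuclideanSpace ℝ (Fin N)))
    have hk1 : Continuous k := (shrinkingBump N n).continuous_normed
    have hk2 : HasCompactSupport k := (shrinkingBump N n).hasCompactSupport_normed
    refine convolution_assoc (ContinuousLinearMap.lsmul ℝ ℝ) (ContinuousLinearMap.lsmul ℝ ℝ)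
      (ContinuousLinearMap.lsmul ℝ ℝ) (ContinuousLinearMap.lsmul ℝ ℝ) ?_
      hk1.aestronglyMeasurable hu.aestronglyMeasurable hκ1.aestronglyMeasurable ?_ ?_ ?_
    · intro a b c; simp [mul_assoc]
    · exact Eventually.of_forall (hk2.convolutionExists_left _ hk1 hu)
    · exact Eventually.of_forall (hκ2.norm.convolutionExists_right _ hun hκ1.norm)
    · exact hk2.norm.convolutionExists_left _ hk1.norm
        (hκ2.norm.continuous_convolution_right _ hun hκ1.norm).locallyIntegrable 0
  simp_rw [e2]
  rw [← e1]
  exact ContDiffBump.convolution_tendsto_right_of_continuous (tendsto_shrinkingBump_rOut N) hwc 0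

end MollifyGradient

/-! ### Almost everywhere convergence of convex combinations -/

/-- The defect in the triangle inequality controls the angle. With `a = ‖A‖`, `b = ‖B‖`, the left
side is `2 (ab - ⟨A, B⟩) / (ab)`, and `2 (ab - ⟨A, B⟩)` factors as `(a + b - ‖A + B‖)(a + b + ‖A +
B‖)`. The second factor is at most `4ab` since `a, b ≥ 1`. -/
theorem norm_sub_normalized_sq_le {G : Type*} [NormedAddCommGroup G] [InnerProductSpace ℝ G]
    {A B : G} (hA : 1 ≤ ‖A‖) (hB : 1 ≤ ‖B‖) :
    ‖‖A‖⁻¹ • A - ‖B‖⁻¹ • B‖ ^ 2 ≤ 4 * (‖A‖ + ‖B‖ - ‖A + B‖) := by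
  have ha : 0 < ‖A‖ := by linarith
  have hb : 0 < ‖B‖ := by linarith
  have h1 : ‖A + B‖ ^ 2 = ‖A‖ ^ 2 + 2 * inner ℝ A B + ‖B‖ ^ 2 := norm_add_sq_real A B
  have h2 : ‖‖A‖⁻¹ • A - ‖B‖⁻¹ • B‖ ^ 2 = 2 * (‖A‖ * ‖B‖ - inner ℝ A B) / (‖A‖ * ‖B‖) := by
    rw [norm_sub_sq_real, norm_smul, norm_smul, norm_inv, norm_inv, norm_norm, norm_norm,
      inv_mul_cancel₀ ha.ne', inv_mul_cancel₀ hb.ne', inner_smul_left, inner_smul_right]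
    simp only [conj_trivial]
    field_simp
    ring
  have h3 : ‖A + B‖ ≤ ‖A‖ + ‖B‖ := norm_add_le A B
  have h4 : ‖A‖ + ‖B‖ ≤ 2 * (‖A‖ * ‖B‖) := by nlinarith
  rw [h2, div_le_iff₀ (by positivity)]
  have h5 : 2 * (‖A‖ * ‖B‖ - inner ℝ A B) = (‖A‖ + ‖B‖ - ‖A + B‖) * (‖A‖ + ‖B‖ + ‖A + B‖) := by
    nlinarith
  rw [h5]
  have h6 : ‖A‖ + ‖B‖ + ‖A + B‖ ≤ 4 * (‖A‖ * ‖B‖) := by linarith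
  calc (‖A‖ + ‖B‖ - ‖A + B‖) * (‖A‖ + ‖B‖ + ‖A + B‖)
      ≤ (‖A‖ + ‖B‖ - ‖A + B‖) * (4 * (‖A‖ * ‖B‖)) :=
        mul_le_mul_of_nonneg_left h6 (by linarith)
    _ = _ := by ring

section Komlos

variable {F : Type*} [NormedAddCommGroup F] [InnerProductSpace ℝ F]

/-- The point of height one over `a`. -/
def affineLift (a : F) : WithLp 2 (ℝ × F) := WithLp.toLp 2 (1, a)

theorem norm_affineLift_sq (a : F) : ‖affineLift a‖ ^ 2 = 1 + ‖a‖ ^ 2 := by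
  rw [WithLp.prod_norm_sq_eq_of_L2]
  simp [affineLift]

theorem one_le_norm_affineLift (a : F) : 1 ≤ ‖affineLift a‖ := by
  have := norm_affineLift_sq a
  nlinarith [norm_nonneg (affineLift a), sq_nonneg ‖a‖]

theorem norm_affineLift_le (a : F) : ‖affineLift a‖ ≤ 1 + ‖a‖ := by
  have := norm_affineLift_sq a
  nlinarith [norm_nonneg (affineLift a), norm_nonneg a]

theorem affineLift_add (a b : F) :
    affineLift a + affineLift b = (2 : ℝ) • affineLift ((1 / 2 : ℝ) • a + (1 / 2 : ℝ) • b) := by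
  unfold affineLift
  rw [← WithLp.toLp_add, ← WithLp.toLp_smul, Prod.mk_add_mk, Prod.smul_mk, smul_add, smul_smul,
    smul_smul]
  norm_num

theorem continuous_affineLift : Continuous (affineLift : F → WithLp 2 (ℝ × F)) :=
  (WithLp.prod_continuous_toLp 2 ℝ F).comp (by fun_prop)

/-- The point of the unit sphere on the ray through `affineLift a`. -/
def sphereLift (a : F) : WithLp 2 (ℝ × F) := ‖affineLift a‖⁻¹ • affineLift a

theorem continuous_sphereLift : Continuous (sphereLift : F → WithLp 2 (ℝ × F)) := by
  refine Continuous.smul (continuous_affineLift.norm.inv₀ fun a => ?_) continuous_affineLift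
  have := one_le_norm_affineLift a
  positivity

theorem sphereLift_fst (a : F) : (sphereLift a).fst = ‖affineLift a‖⁻¹ := by
  simp [sphereLift, affineLift]

theorem sphereLift_snd (a : F) : (sphereLift a).snd = ‖affineLift a‖⁻¹ • a := by
  simp [sphereLift, affineLift]

/-- A quantitative strict convexity of `a ↦ ‖affineLift a‖ = √(1 + ‖a‖²)`. The lift to height one
makes distinct points lie on distinct rays, which the norm itself would not distinguish. -/
theorem norm_sphereLift_sub_sq_le (a b : F) :
    ‖sphereLift a - sphereLift b‖ ^ 2 ≤ 4 * (‖affineLift a‖ + ‖affineLift b‖ -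
      2 * ‖affineLift ((1 / 2 : ℝ) • a + (1 / 2 : ℝ) • b)‖) := by
  have := norm_sub_normalized_sq_le (one_le_norm_affineLift a) (one_le_norm_affineLift b)
  rwa [affineLift_add, norm_smul, Real.norm_of_nonneg zero_le_two] at this

/-- A sequence converges if its lifts to the unit sphere converge and it does not diverge to
infinity. -/
theorem exists_tendsto_of_tendsto_sphereLift {a : ℕ → F} {l : WithLp 2 (ℝ × F)}
    (hl : Tendsto (fun n => sphereLift (a n)) atTop (𝓝 l)) {R : ℝ}
    (hR : ∃ᶠ n in atTop, ‖a n‖ ≤ R) : ∃ b : F, Tendsto a atTop (𝓝 b) := by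
  have h1 : Tendsto (fun n => ‖affineLift (a n)‖⁻¹) atTop (𝓝 l.fst) := by
    have := ((WithLp.prod_continuous_ofLp 2 ℝ F).fst.tendsto l).comp hl
    refine this.congr fun n => ?_
    exact sphereLift_fst (a n)
  have h2 : Tendsto (fun n => ‖affineLift (a n)‖⁻¹ • a n) atTop (𝓝 l.snd) := by
    have := ((WithLp.prod_continuous_ofLp 2 ℝ F).snd.tendsto l).comp hl
    refine this.congr fun n => ?_
    exact sphereLift_snd (a n)
  have hR0 : 0 ≤ R := by
    obtain ⟨n, hn⟩ := hR.exists
    exact (norm_nonneg _).trans hn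
  -- The limit could leave the chart only through the equator, where the first coordinate vanishes;
  -- recurrent boundedness excludes this.
  have h3 : (1 + R)⁻¹ ≤ l.fst := by
    refine ge_of_tendsto_of_frequently h1 (hR.mono fun n hn => ?_)
    have := one_le_norm_affineLift (a n)
    exact inv_anti₀ (by linarith) ((norm_affineLift_le _).trans (by linarith))
  have h4 : l.fst ≠ 0 := (lt_of_lt_of_le (by positivity) h3).ne'
  refine ⟨l.fst⁻¹ • l.snd, ((h1.inv₀ h4).smul h2).congr fun n => ?_⟩
  have := one_le_norm_affineLift (a n)
  rw [inv_inv, smul_inv_smul₀ (by linarith)]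

variable {α : Type*} [MeasurableSpace α] [FiniteDimensional ℝ F] [MeasurableSpace F] [BorelSpace F]

theorem ENNReal.le_one_add_rpow (x : ℝ≥0∞) {p : ℝ} (hp : 1 ≤ p) : x ≤ 1 + x ^ p := by
  rcases le_total x 1 with h | h
  · exact h.trans le_self_add
  · calc x = x ^ (1 : ℝ) := (ENNReal.rpow_one x).symm
      _ ≤ x ^ p := ENNReal.rpow_le_rpow_of_exponent_le h hp
      _ ≤ _ := le_add_self

/-- Finiteness makes the constant in `‖affineLift a‖ ≤ 1 + ‖a‖` integrable, `μ' ≤ μ` preserves the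
`L^p` bounds, and `μ ≪ μ'` carries almost everywhere convergence back to `μ`. -/
theorem exists_isFiniteMeasure_le_absolutelyContinuous (μ : Measure α) [SigmaFinite μ] :
    ∃ μ' : Measure α, IsFiniteMeasure μ' ∧ μ' ≤ μ ∧ μ ≪ μ' := by
  obtain ⟨g, hg0, hgm, hgi⟩ := exists_pos_lintegral_lt_of_sigmaFinite μ one_ne_zero
  have hm : Measurable fun x => ((min (g x) 1 : ℝ≥0) : ℝ≥0∞) := by fun_prop
  refine ⟨μ.withDensity fun x => ((min (g x) 1 : ℝ≥0) : ℝ≥0∞), ?_, ?_, ?_⟩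
  · refine isFiniteMeasure_withDensity (ne_top_of_lt (lt_of_le_of_lt ?_ hgi))
    exact lintegral_mono fun x => by gcongr; exact min_le_left _ _
  · calc μ.withDensity (fun x => ((min (g x) 1 : ℝ≥0) : ℝ≥0∞)) ≤ μ.withDensity 1 :=
          withDensity_mono (Eventually.of_forall fun x => by
            simpa using min_le_right (g x) 1)
      _ = μ := withDensity_one
  · refine withDensity_absolutelyContinuous' hm.aemeasurable (Eventually.of_forall fun x => ?_)
    simp [(hg0 x).ne']

theorem convexHull_subset_eLpNorm_le {μ : Measure α} {q : ℝ≥0∞} (hq : 1 ≤ q) {K : ℝ≥0∞}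
    {s : Set (α → F)} (hs : ∀ f ∈ s, Measurable f ∧ eLpNorm f q μ ≤ K) :
    ∀ f ∈ convexHull ℝ s, Measurable f ∧ eLpNorm f q μ ≤ K := by
  have : convexHull ℝ s ⊆ {f | Measurable f ∧ eLpNorm f q μ ≤ K} := by
    refine convexHull_min hs ?_
    rintro f ⟨hf, hfK⟩ g ⟨hg, hgK⟩ a b ha hb hab
    refine ⟨(hf.const_smul a).add (hg.const_smul b), ?_⟩
    refine (eLpNorm_add_le (hf.const_smul a).aestronglyMeasurable
      (hg.const_smul b).aestronglyMeasurable hq).trans ?_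
    rw [eLpNorm_const_smul, eLpNorm_const_smul]
    calc ‖a‖ₑ * eLpNorm f q μ + ‖b‖ₑ * eLpNorm g q μ ≤ ‖a‖ₑ * K + ‖b‖ₑ * K := by gcongr
      _ = K := by
        rw [← add_mul, ← ofReal_norm, ← ofReal_norm, Real.norm_of_nonneg ha,
          Real.norm_of_nonneg hb, ← ENNReal.ofReal_add ha hb, hab, ENNReal.ofReal_one, one_mul]
  exact this

/-- Minimizing the strictly convex functional `∫ ‖affineLift h‖` along decreasing convex sets gives
a sequence whose lifts to the sphere are Cauchy in `L²`. -/
theorem exists_sphereLift_cauchy {μ : Measure α} {C : ℕ → Set (α → F)}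
    (hC : ∀ n, Convex ℝ (C n)) (hanti : Antitone C) (hne : ∀ n, (C n).Nonempty) {B : ℝ}
    (hi : ∀ n, ∀ h ∈ C n, Integrable (fun x => ‖affineLift (h x)‖) μ)
    (hB : ∀ n, ∀ h ∈ C n, ∫ x, ‖affineLift (h x)‖ ∂μ ≤ B) :
    ∃ h : ℕ → α → F, (∀ n, h n ∈ C n) ∧ ∃ η : ℕ → ℝ, Tendsto η atTop (𝓝 0) ∧
      ∀ N n m, N ≤ n → N ≤ m → ∫⁻ x, ‖sphereLift (h n x) - sphereLift (h m x)‖ₑ ^ (2 : ℝ) ∂μ ≤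
        ENNReal.ofReal (η N) := by
  set Φ : (α → F) → ℝ := fun h => ∫ x, ‖affineLift (h x)‖ ∂μ with hΦ
  have hΦ0 : ∀ h, 0 ≤ Φ h := fun h => integral_nonneg fun x => norm_nonneg _
  have hbdd : ∀ n, BddBelow (Φ '' C n) := fun n => ⟨0, by rintro _ ⟨h, -, rfl⟩; exact hΦ0 h⟩
  have hne' : ∀ n, (Φ '' C n).Nonempty := fun n => (hne n).image Φ
  set s : ℕ → ℝ := fun n => sInf (Φ '' C n) with hs
  have hsmono : Monotone s := fun n m hnm =>
    csInf_le_csInf (hbdd n) (hne' m) (image_mono (hanti hnm))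
  have hsB : ∀ n, s n ≤ B := by
    intro n
    obtain ⟨h, hh⟩ := hne n
    exact (csInf_le (hbdd n) (mem_image_of_mem Φ hh)).trans (hB n h hh)
  have hsbdd : BddAbove (range s) := ⟨B, by rintro _ ⟨n, rfl⟩; exact hsB n⟩
  have hchoice : ∀ n : ℕ, ∃ h ∈ C n, Φ h < s n + 1 / ((n : ℝ) + 1) := by
    intro n
    have hlt : s n < s n + 1 / ((n : ℝ) + 1) := lt_add_of_pos_right _ (by positivity)
    obtain ⟨_, ⟨h, hh, rfl⟩, hlt'⟩ := exists_lt_of_csInf_lt (hne' n) hlt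
    exact ⟨h, hh, hlt'⟩
  choose h hh hlt using hchoice
  set S := ⨆ n, s n with hS
  have hle : ∀ n, s n ≤ S := fun n => le_ciSup hsbdd n
  refine ⟨h, hh, fun n => 4 * (S - s n + 2 * (1 / ((n : ℝ) + 1))), ?_, ?_⟩
  · have h1 : Tendsto s atTop (𝓝 S) := tendsto_atTop_ciSup hsmono hsbdd
    have h2 := ((tendsto_const_nhds (x := S)).sub h1).add
      ((tendsto_one_div_add_atTop_nhds_zero_nat (𝕜 := ℝ)).const_mul 2) |>.const_mul 4
    simpa using h2
  -- The midpoint of `h n` and `h m` still lies in `C n`, so its functional is at least `s n`. Both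
  -- endpoints are nearly minimal for infima that increase to `S`, which leaves a small convexity
  -- defect.
  · have key : ∀ N n m, N ≤ n → n ≤ m →
        ∫⁻ x, ‖sphereLift (h n x) - sphereLift (h m x)‖ₑ ^ (2 : ℝ) ∂μ ≤
          ENNReal.ofReal (4 * (S - s N + 2 * (1 / ((N : ℝ) + 1)))) := by
      intro N n m hNn hnm
      set mid : α → F := (1 / 2 : ℝ) • h n + (1 / 2 : ℝ) • h m with hmid
      have hmem : mid ∈ C n := hC n (hh n) (hanti hnm (hh m)) (by norm_num) (by norm_num)
        (by norm_num)
      have hin := hi n _ (hh n)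
      have him := hi m _ (hh m)
      have himid := hi n _ hmem
      have hsn : s n ≤ Φ mid := csInf_le (hbdd n) (mem_image_of_mem Φ hmem)
      have hint : Integrable (fun x => 4 * (‖affineLift (h n x)‖ + ‖affineLift (h m x)‖ -
          2 * ‖affineLift (mid x)‖)) μ :=
        ((hin.add him).sub (himid.const_mul 2)).const_mul 4
      have hpt : ∀ x, ‖sphereLift (h n x) - sphereLift (h m x)‖ ^ 2 ≤
          4 * (‖affineLift (h n x)‖ + ‖affineLift (h m x)‖ - 2 * ‖affineLift (mid x)‖) :=
        fun x => norm_sphereLift_sub_sq_le _ _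
      calc ∫⁻ x, ‖sphereLift (h n x) - sphereLift (h m x)‖ₑ ^ (2 : ℝ) ∂μ
          ≤ ∫⁻ x, ENNReal.ofReal (4 * (‖affineLift (h n x)‖ + ‖affineLift (h m x)‖ -
              2 * ‖affineLift (mid x)‖)) ∂μ := by
            refine lintegral_mono fun x => ?_
            rw [← ofReal_norm, ENNReal.ofReal_rpow_of_nonneg (norm_nonneg _) zero_le_two,
              Real.rpow_two]
            exact ENNReal.ofReal_le_ofReal (hpt x)
        _ = ENNReal.ofReal (4 * (Φ (h n) + Φ (h m) - 2 * Φ mid)) := by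
            rw [← ofReal_integral_eq_lintegral_ofReal hint
              (Eventually.of_forall fun x => (sq_nonneg _).trans (hpt x)), integral_const_mul,
              integral_sub (f := fun x => ‖affineLift (h n x)‖ + ‖affineLift (h m x)‖) (hin.add him)
                (himid.const_mul 2), integral_add hin him,
              integral_const_mul]
        _ ≤ _ := by
            refine ENNReal.ofReal_le_ofReal ?_
            have h1 := hlt n
            have h2 := hlt m
            have h3 : 1 / ((n : ℝ) + 1) ≤ 1 / ((N : ℝ) + 1) :=
              Nat.one_div_le_one_div hNn
            have h4 : 1 / ((m : ℝ) + 1) ≤ 1 / ((N : ℝ) + 1) :=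
              Nat.one_div_le_one_div (hNn.trans hnm)
            have h5 := hle m
            have h6 := hsmono hNn
            linarith
    intro N n m hn hm
    rcases le_total n m with hnm | hnm
    · exact key N n m hn hnm
    · have := key N m n hm hnm
      simp_rw [← enorm_neg (sphereLift (h n _) - sphereLift (h m _)), neg_sub]
      exact this

/-- A sequence bounded in `L^p` has convex combinations that converge almost everywhere. -/
theorem exists_convexCombination_ae_tendsto {μ : Measure α} [SigmaFinite μ] {p : ℝ} (hp : 1 ≤ p)
    {f : ℕ → α → F} (hf : ∀ n, Measurable (f n)) {K : ℝ≥0}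
    (hK : ∀ n, eLpNorm (f n) (ENNReal.ofReal p) μ ≤ K) :
    ∃ (h : ℕ → α → F) (g : α → F), (∀ n, h n ∈ convexHull ℝ (f '' Ici n)) ∧
      (∀ n, Measurable (h n)) ∧ (∀ n, eLpNorm (h n) (ENNReal.ofReal p) μ ≤ K) ∧
      Measurable g ∧ eLpNorm g (ENNReal.ofReal p) μ ≤ K ∧
      ∀ᵐ x ∂μ, Tendsto (fun n => h n x) atTop (𝓝 (g x)) := by
  have hp0 : 0 < p := by linarith
  have hq : 1 ≤ ENNReal.ofReal p := by simpa using hp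
  obtain ⟨μ', hfin, hle, hac⟩ := exists_isFiniteMeasure_le_absolutelyContinuous μ
  set C : ℕ → Set (α → F) := fun n => convexHull ℝ (f '' Ici n) with hCdef
  have hanti : Antitone C := fun n m hnm => convexHull_mono (image_mono (Ici_subset_Ici.2 hnm))
  have hCK : ∀ n, ∀ h ∈ C n, Measurable h ∧ eLpNorm h (ENNReal.ofReal p) μ ≤ K := fun n =>
    convexHull_subset_eLpNorm_le hq (by rintro _ ⟨m, -, rfl⟩; exact ⟨hf m, hK m⟩)
  have hlin : ∀ n, ∀ h ∈ C n, ∫⁻ x, ‖‖affineLift (h x)‖‖ₑ ∂μ' ≤ 2 * μ' univ + (K : ℝ≥0∞) ^ p := by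
    intro n h hh
    have h1 : ∫⁻ x, ‖h x‖ₑ ^ p ∂μ' ≤ (K : ℝ≥0∞) ^ p := by
      rw [← eLpNorm_ofReal_rpow_eq _ hp0]
      exact ENNReal.rpow_le_rpow ((eLpNorm_mono_measure _ hle).trans (hCK n h hh).2) hp0.le
    calc ∫⁻ x, ‖‖affineLift (h x)‖‖ₑ ∂μ' ≤ ∫⁻ x, (2 + ‖h x‖ₑ ^ p) ∂μ' := by
          refine lintegral_mono fun x => ?_
          rw [enorm_norm, ← ofReal_norm]
          calc ENNReal.ofReal ‖affineLift (h x)‖ ≤ ENNReal.ofReal (1 + ‖h x‖) :=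
                ENNReal.ofReal_le_ofReal (norm_affineLift_le _)
            _ = 1 + ‖h x‖ₑ := by
                rw [ENNReal.ofReal_add zero_le_one (norm_nonneg _), ENNReal.ofReal_one, ofReal_norm]
            _ ≤ 1 + (1 + ‖h x‖ₑ ^ p) := by gcongr; exact ENNReal.le_one_add_rpow _ hp
            _ = _ := by rw [← add_assoc, one_add_one_eq_two]
      _ = 2 * μ' univ + ∫⁻ x, ‖h x‖ₑ ^ p ∂μ' := by
          rw [lintegral_add_left measurable_const, lintegral_const]
      _ ≤ _ := by gcongr
  have hBt : 2 * μ' univ + (K : ℝ≥0∞) ^ p ≠ ⊤ := by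
    refine ENNReal.add_ne_top.2 ⟨ENNReal.mul_ne_top ENNReal.ofNat_ne_top (measure_ne_top _ _), ?_⟩
    exact ENNReal.rpow_ne_top_of_nonneg hp0.le ENNReal.coe_ne_top
  have hint : ∀ n, ∀ h ∈ C n, Integrable (fun x => ‖affineLift (h x)‖) μ' := by
    intro n h hh
    refine ⟨(continuous_affineLift.norm.measurable.comp (hCK n h hh).1).aestronglyMeasurable, ?_⟩
    exact lt_of_le_of_lt (hlin n h hh) hBt.lt_top
  have hB : ∀ n, ∀ h ∈ C n, ∫ x, ‖affineLift (h x)‖ ∂μ' ≤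
      (2 * μ' univ + (K : ℝ≥0∞) ^ p).toReal := by
    intro n h hh
    rw [integral_eq_lintegral_of_nonneg_ae (Eventually.of_forall fun x => norm_nonneg _)
      (hint n h hh).1]
    refine ENNReal.toReal_mono hBt (le_trans (le_of_eq ?_) (hlin n h hh))
    congr 1 with x
    rw [enorm_norm, ofReal_norm]
  obtain ⟨h, hhC, η, hη, hcau⟩ := exists_sphereLift_cauchy (μ := μ') (C := C)
    (fun n => convex_convexHull ℝ _) hanti
    (fun n => ⟨f n, subset_convexHull ℝ _ (mem_image_of_mem f self_mem_Ici)⟩)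
    hint hB
  -- Squared `L²` distances below `4 ^ (-j)` give distances below `2 ^ (-j)`; these are summable,
  -- which yields almost everywhere convergence.
  obtain ⟨ψ, hψ, hψη⟩ := extraction_forall_of_eventually' (P := fun j N => η N < (1 / 4 : ℝ) ^ j)
    (fun j => (hη.eventually_lt_const (by positivity)).exists_forall_of_atTop)
  set h' : ℕ → α → F := fun j => h (ψ j) with hh'
  have hmem : ∀ j, h' j ∈ C j := fun j => hanti (hψ.id_le j) (hhC (ψ j))
  have hmeas : ∀ j, Measurable (h' j) := fun j => (hCK j _ (hmem j)).1
  have hnorm : ∀ j, eLpNorm (h' j) (ENNReal.ofReal p) μ ≤ K := fun j => (hCK j _ (hmem j)).2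
  have hsph : ∀ᵐ x ∂μ', ∃ l, Tendsto (fun j => sphereLift (h' j x)) atTop (𝓝 l) := by
    refine Lp.ae_tendsto_of_cauchy_eLpNorm (p := ENNReal.ofReal 2) (B := fun j => (1 / 2) ^ j)
      (fun j => (continuous_sphereLift.measurable.comp (hmeas j)).aestronglyMeasurable)
      (by simp) ?_ ?_
    · rw [ENNReal.tsum_geometric]; simp
    · intro N n m hn hm
      rw [← ENNReal.rpow_lt_rpow_iff (z := 2) two_pos, eLpNorm_ofReal_rpow_eq _ two_pos]
      refine lt_of_le_of_lt (hcau (ψ N) (ψ n) (ψ m) (hψ.monotone hn) (hψ.monotone hm)) ?_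
      have h1 : ((1 / 2 : ℝ≥0∞) ^ N) ^ (2 : ℝ) = ENNReal.ofReal ((1 / 4 : ℝ) ^ N) := by
        rw [ENNReal.rpow_two, ← pow_mul, mul_comm, pow_mul, ENNReal.ofReal_pow (by norm_num)]
        congr 1
        rw [show (1 / 4 : ℝ) = (1 / 2) ^ 2 by norm_num, ENNReal.ofReal_pow (by norm_num)]
        congr 1
        rw [ENNReal.ofReal_div_of_pos two_pos]; simp
      rw [h1]
      exact (ENNReal.ofReal_lt_ofReal_iff (by positivity)).2 (hψη N)
  have hbd := ae_bdd_liminf_atTop_of_eLpNorm_bdd (R := K) (by simpa using hp0) hmeas hnorm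
  -- Convergence on the sphere still allows escape to infinity in `F`; the `L^p` bound makes the
  -- liminf of the norms finite almost everywhere.
  have hconv : ∀ᵐ x ∂μ, ∃ b, Tendsto (fun j => h' j x) atTop (𝓝 b) := by
    filter_upwards [hac.ae_le hsph, hbd] with x ⟨l, hl⟩ hx
    obtain ⟨R, hR1, hR2⟩ := ENNReal.lt_iff_exists_nnreal_btwn.1 hx
    refine exists_tendsto_of_tendsto_sphereLift hl (R := R) ?_
    refine (frequently_lt_of_liminf_lt (by isBoundedDefault) hR1).mono fun j hj => ?_
    rw [enorm_lt_coe] at hj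
    exact hj.le
  obtain ⟨g, hgm, hg⟩ := measurable_limit_of_tendsto_metrizable_ae
    (fun j => (hmeas j).aemeasurable) hconv
  refine ⟨h', g, hmem, hmeas, hnorm, hgm, ?_, hg⟩
  refine (Lp.eLpNorm_lim_le_liminf_eLpNorm (fun j => (hmeas j).aestronglyMeasurable) g hg).trans ?_
  exact liminf_le_of_frequently_le' (Frequently.of_forall hnorm)

end Komlos

/-! ### Weak limits and weak gradients -/

section WeakLimit

variable {α : Type*} [MeasurableSpace α] {μ : Measure α}

theorem integrable_mul_of_eLpNorm_lt_top {p : ℝ} (hp : 1 ≤ p) {w ψ : α → ℝ} (hw : Measurable w)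
    (hK : eLpNorm w (ENNReal.ofReal p) μ < ⊤) (hψ : Integrable ψ μ) {B : ℝ≥0}
    (hB : ∀ x, ‖ψ x‖ₑ ≤ B) : Integrable (fun x => w x * ψ x) μ := by
  have hp0 : 0 < p := by linarith
  refine ⟨hw.aestronglyMeasurable.mul hψ.1, ?_⟩
  calc ∫⁻ x, ‖w x * ψ x‖ₑ ∂μ ≤ ∫⁻ x, (‖ψ x‖ₑ + B * ‖w x‖ₑ ^ p) ∂μ := by
        refine lintegral_mono fun x => ?_
        rw [enorm_mul]
        calc ‖w x‖ₑ * ‖ψ x‖ₑ ≤ (1 + ‖w x‖ₑ ^ p) * ‖ψ x‖ₑ := by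
              gcongr; exact ENNReal.le_one_add_rpow _ hp
          _ = ‖ψ x‖ₑ + ‖ψ x‖ₑ * ‖w x‖ₑ ^ p := by ring
          _ ≤ _ := by gcongr; exact hB x
    _ = ∫⁻ x, ‖ψ x‖ₑ ∂μ + B * eLpNorm w (ENNReal.ofReal p) μ ^ p := by
        rw [lintegral_add_left' hψ.1.enorm, lintegral_const_mul' _ _ ENNReal.coe_ne_top,
          eLpNorm_ofReal_rpow_eq _ hp0]
    _ < ⊤ := ENNReal.add_lt_top.2 ⟨hψ.2, ENNReal.mul_lt_top ENNReal.coe_lt_top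
        (ENNReal.rpow_lt_top_of_nonneg hp0.le hK.ne)⟩

theorem ENNReal.le_min_add_rpow (x : ℝ≥0∞) {p M : ℝ} (hp : 1 ≤ p) (hM : 0 < M) :
    x ≤ min x (ENNReal.ofReal M) + ENNReal.ofReal (M ^ (1 - p)) * x ^ p := by
  rcases le_or_gt x (ENNReal.ofReal M) with h | h
  · rw [min_eq_left h]; exact le_self_add
  · refine le_trans ?_ le_add_self
    rcases eq_or_ne x ⊤ with rfl | hx
    · rw [ENNReal.top_rpow_of_pos (by linarith), ENNReal.mul_top]
      exact (ENNReal.ofReal_pos.2 (by positivity)).ne'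
    · lift x to ℝ≥0 using hx
      have hMx : M < x := by
        rwa [ENNReal.ofReal_lt_coe_iff hM.le] at h
      have hx0 : (0 : ℝ) < x := hM.trans hMx
      rw [← ENNReal.ofReal_coe_nnreal, ENNReal.ofReal_rpow_of_pos hx0,
        ← ENNReal.ofReal_mul (by positivity)]
      refine ENNReal.ofReal_le_ofReal ?_
      calc (x : ℝ) = (x : ℝ) ^ (1 - p) * (x : ℝ) ^ p := by
            rw [← Real.rpow_add hx0]; simp
        _ ≤ M ^ (1 - p) * (x : ℝ) ^ p := by
            gcongr ?_ * _
            exact Real.rpow_le_rpow_of_nonpos hM hMx.le (by linarith)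

/-- Uniform integrability from `p > 1`: the difference truncated at height `M` tends to zero by
dominated convergence against `|ψ|`, while the excess is at most `M ^ (1 - p)` times a constant,
uniformly in `n`. -/
theorem tendsto_integral_mul_of_ae_tendsto {p : ℝ} (hp : 1 < p) {w : ℕ → α → ℝ} {v ψ : α → ℝ}
    (hw : ∀ n, Measurable (w n)) (hv : Measurable v) {K : ℝ≥0}
    (hwK : ∀ n, eLpNorm (w n) (ENNReal.ofReal p) μ ≤ K)
    (hvK : eLpNorm v (ENNReal.ofReal p) μ ≤ K)
    (hlim : ∀ᵐ x ∂μ, Tendsto (fun n => w n x) atTop (𝓝 (v x)))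
    (hψ : Integrable ψ μ) {B : ℝ≥0} (hB : ∀ x, ‖ψ x‖ₑ ≤ B) :
    Tendsto (fun n => ∫ x, w n x * ψ x ∂μ) atTop (𝓝 (∫ x, v x * ψ x ∂μ)) := by
  have hp0 : 0 < p := by linarith
  refine tendsto_integral_of_L1 _
    (integrable_mul_of_eLpNorm_lt_top hp.le hv (hvK.trans_lt ENNReal.coe_lt_top) hψ hB).1
    (Eventually.of_forall fun n => integrable_mul_of_eLpNorm_lt_top hp.le (hw n)
      ((hwK n).trans_lt ENNReal.coe_lt_top) hψ hB) ?_
  have hq : 1 ≤ ENNReal.ofReal p := by simpa using hp.le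
  set A : ℝ := B * (2 * K : ℝ) ^ p with hA
  have hA0 : 0 ≤ A := by positivity
  have hdiff : ∀ n, ∫⁻ x, ‖w n x - v x‖ₑ ^ p ∂μ ≤ ENNReal.ofReal ((2 * K : ℝ) ^ p) := by
    intro n
    have h1 : eLpNorm (w n - v) (ENNReal.ofReal p) μ ≤ ENNReal.ofReal (2 * K) := by
      refine (eLpNorm_sub_le (hw n).aestronglyMeasurable hv.aestronglyMeasurable hq).trans ?_
      refine (add_le_add (hwK n) hvK).trans (le_of_eq ?_)
      rw [two_mul, ENNReal.ofReal_add K.coe_nonneg K.coe_nonneg, ENNReal.ofReal_coe_nnreal]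
    have h2 := ENNReal.rpow_le_rpow h1 hp0.le
    rw [eLpNorm_ofReal_rpow_eq _ hp0, ENNReal.ofReal_rpow_of_nonneg (by positivity) hp0.le] at h2
    exact h2
  have hsplit : ∀ n, ∀ M : ℝ, 0 < M → ∫⁻ x, ‖w n x * ψ x - v x * ψ x‖ₑ ∂μ ≤
      ∫⁻ x, min ‖w n x - v x‖ₑ (ENNReal.ofReal M) * ‖ψ x‖ₑ ∂μ +
        ENNReal.ofReal (M ^ (1 - p) * A) := by
    intro n M hM
    calc ∫⁻ x, ‖w n x * ψ x - v x * ψ x‖ₑ ∂μ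
        ≤ ∫⁻ x, (min ‖w n x - v x‖ₑ (ENNReal.ofReal M) * ‖ψ x‖ₑ +
            ENNReal.ofReal (M ^ (1 - p)) * B * ‖w n x - v x‖ₑ ^ p) ∂μ := by
          refine lintegral_mono fun x => ?_
          rw [← sub_mul, enorm_mul]
          calc ‖w n x - v x‖ₑ * ‖ψ x‖ₑ ≤ (min ‖w n x - v x‖ₑ (ENNReal.ofReal M) +
                ENNReal.ofReal (M ^ (1 - p)) * ‖w n x - v x‖ₑ ^ p) * ‖ψ x‖ₑ := by
                gcongr; exact ENNReal.le_min_add_rpow _ hp.le hM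
            _ = min ‖w n x - v x‖ₑ (ENNReal.ofReal M) * ‖ψ x‖ₑ +
                ENNReal.ofReal (M ^ (1 - p)) * ‖ψ x‖ₑ * ‖w n x - v x‖ₑ ^ p := by ring
            _ ≤ _ := by gcongr; exact hB x
      _ = ∫⁻ x, min ‖w n x - v x‖ₑ (ENNReal.ofReal M) * ‖ψ x‖ₑ ∂μ +
            ENNReal.ofReal (M ^ (1 - p)) * B * ∫⁻ x, ‖w n x - v x‖ₑ ^ p ∂μ := by
          rw [lintegral_add_right _ (by fun_prop), lintegral_const_mul _ (by fun_prop)]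
      _ ≤ _ := by
          refine add_le_add le_rfl ((mul_le_mul' le_rfl (hdiff n)).trans (le_of_eq ?_))
          rw [hA, ENNReal.ofReal_mul (by positivity), ENNReal.ofReal_mul B.coe_nonneg,
            ENNReal.ofReal_coe_nnreal, mul_assoc]
  have hdct : ∀ M : ℝ, Tendsto (fun n => ∫⁻ x, min ‖w n x - v x‖ₑ (ENNReal.ofReal M) * ‖ψ x‖ₑ ∂μ)
      atTop (𝓝 0) := by
    intro M
    have h0 : (0 : ℝ≥0∞) = ∫⁻ _, 0 ∂μ := by simp
    rw [h0]
    refine tendsto_lintegral_of_dominated_convergence' (fun x => ENNReal.ofReal M * ‖ψ x‖ₑ)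
      (fun n => ?_) (fun n => Eventually.of_forall fun x => ?_) ?_ ?_
    · exact (show Measurable fun x => min ‖w n x - v x‖ₑ (ENNReal.ofReal M) by
        fun_prop).aemeasurable.mul hψ.1.enorm
    · exact mul_le_mul' (min_le_right _ _) le_rfl
    · rw [lintegral_const_mul' _ _ ENNReal.ofReal_ne_top]
      exact ENNReal.mul_ne_top ENNReal.ofReal_ne_top hψ.2.ne
    · filter_upwards [hlim] with x hx
      have h1 : Tendsto (fun n => ‖w n x - v x‖ₑ) atTop (𝓝 0) := by
        have := (hx.sub_const (v x)).enorm
        simpa using this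
      have h2 : Tendsto (fun n => min ‖w n x - v x‖ₑ (ENNReal.ofReal M)) atTop (𝓝 0) :=
        tendsto_of_tendsto_of_tendsto_of_le_of_le tendsto_const_nhds h1 (fun _ => zero_le)
          (fun _ => min_le_left _ _)
      have h3 := ENNReal.Tendsto.mul_const (b := ‖ψ x‖ₑ) h2 (Or.inr enorm_ne_top)
      rwa [zero_mul] at h3
  rw [ENNReal.tendsto_nhds_zero]
  intro ε hε
  have hMlim : Tendsto (fun M : ℝ => ENNReal.ofReal (M ^ (1 - p) * A)) atTop (𝓝 0) := by
    have h1 := (tendsto_rpow_neg_atTop (y := p - 1) (by linarith)).mul_const A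
    rw [neg_sub, zero_mul] at h1
    have h2 := ENNReal.tendsto_ofReal h1
    rwa [ENNReal.ofReal_zero] at h2
  have hε2 : 0 < ε / 2 := ENNReal.half_pos hε.ne'
  obtain ⟨M, hMε, hM0⟩ := ((ENNReal.tendsto_nhds_zero.1 hMlim _ hε2).and
    (eventually_gt_atTop (0 : ℝ))).exists
  filter_upwards [ENNReal.tendsto_nhds_zero.1 (hdct M) _ hε2] with n hn
  refine (hsplit n M hM0).trans ((add_le_add hn hMε).trans (le_of_eq (ENNReal.add_halves ε)))

end WeakLimit

section WeakGradient

variable {N : ℕ}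

theorem continuous_gradient {v : EuclideanSpace ℝ (Fin N) → ℝ} (hv : ContDiff ℝ 1 v) :
    Continuous (gradient v) :=
  (LinearIsometryEquiv.continuous _).comp (hv.continuous_fderiv one_ne_zero)

theorem integral_gradient_mul {v φ : EuclideanSpace ℝ (Fin N) → ℝ} (hv : ContDiff ℝ 1 v)
    (hφ : ContDiff ℝ ∞ φ) (hφc : HasCompactSupport φ) (i : Fin N) :
    ∫ x, gradient v x i * φ x = - ∫ x, v x * fderiv ℝ φ x (EuclideanSpace.single i 1) := by
  have hφ' : Continuous fun x => fderiv ℝ φ x (EuclideanSpace.single i 1) := by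
    have := hφ.continuous_fderiv (by simp)
    fun_prop
  have hφ'c : HasCompactSupport fun x => fderiv ℝ φ x (EuclideanSpace.single i (1 : ℝ)) :=
    (hφc.fderiv ℝ).comp_left (g := fun L : EuclideanSpace ℝ (Fin N) →L[ℝ] ℝ =>
      L (EuclideanSpace.single i 1)) rfl
  have hv' : Continuous fun x => fderiv ℝ v x (EuclideanSpace.single i 1) := by
    have := hv.continuous_fderiv one_ne_zero
    fun_prop
  simp_rw [gradient_apply_eq]
  rw [integral_mul_fderiv_eq_neg_fderiv_mul_of_integrable, neg_neg]
  · exact (hv'.mul hφ.continuous).integrable_of_hasCompactSupport hφc.mul_left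
  · exact (hv.continuous.mul hφ').integrable_of_hasCompactSupport hφ'c.mul_left
  · exact (hv.continuous.mul hφ.continuous).integrable_of_hasCompactSupport hφc.mul_left
  · exact fun x _ => hv.differentiable one_ne_zero x
  · exact fun x _ => hφ.differentiable (by simp) x

/-- A locally integrable function whose mollifications have gradients bounded in `L^p` belongs to
the homogeneous Sobolev space. -/
theorem memHomogeneousSobolev_of_eLpNorm_gradient_mollify_le {p : ℝ} (hp : 1 < p)
    {u : EuclideanSpace ℝ (Fin N) → ℝ} (hu : LocallyIntegrable u) {K : ℝ≥0}
    (hK : ∀ n, eLpNorm (gradient (mollify (shrinkingBump N n) u)) (ENNReal.ofReal p) volume ≤ K) :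
    MemHomogeneousSobolev p u := by
  have hp0 : 0 < p := by linarith
  have hq : 1 ≤ ENNReal.ofReal p := by simpa using hp.le
  have hv : ∀ n, ContDiff ℝ 1 (mollify (shrinkingBump N n) u) := fun n =>
    contDiff_mollify (n := 1) _ hu
  obtain ⟨h, g, hmem, hhm, hhK, hgm, hgK, hlim⟩ := exists_convexCombination_ae_tendsto
    (μ := (volume : Measure (EuclideanSpace ℝ (Fin N)))) hp.le
    (fun n => (continuous_gradient (hv n)).measurable) hK
  have hgLp : MemLp g (ENNReal.ofReal p) volume :=
    ⟨hgm.aestronglyMeasurable, hgK.trans_lt ENNReal.coe_lt_top⟩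
  refine ⟨hu, g, ⟨hgLp.locallyIntegrable hq, fun φ hφ hφc i => ?_⟩, hgLp⟩
  have hcomp : ∀ f : EuclideanSpace ℝ (Fin N) → EuclideanSpace ℝ (Fin N),
      eLpNorm (fun x => f x i) (ENNReal.ofReal p) volume ≤ eLpNorm f (ENNReal.ofReal p) volume :=
    fun f => eLpNorm_mono fun x => PiLp.norm_apply_le (f x) i
  have hmi : ∀ f : EuclideanSpace ℝ (Fin N) → EuclideanSpace ℝ (Fin N), Measurable f →
      Measurable fun x => f x i := fun f hf =>
    (EuclideanSpace.proj (𝕜 := ℝ) i).continuous.measurable.comp hf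
  have hφi : Integrable φ := hφ.continuous.integrable_of_hasCompactSupport hφc
  obtain ⟨B, hB⟩ := hφ.continuous.bounded_above_of_compact_support hφc
  have hB' : ∀ x, ‖φ x‖ₑ ≤ (B.toNNReal : ℝ≥0∞) := fun x => by
    rw [← ofReal_norm]; exact ENNReal.ofReal_le_ofReal (hB x)
  have hT1 : Tendsto (fun n => ∫ x, h n x i * φ x) atTop (𝓝 (∫ x, g x i * φ x)) := by
    refine tendsto_integral_mul_of_ae_tendsto (K := K) hp (fun n => hmi _ (hhm n)) (hmi _ hgm)
      (fun n => (hcomp _).trans (hhK n)) ((hcomp _).trans hgK) ?_ hφi hB'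
    filter_upwards [hlim] with x hx
    exact ((EuclideanSpace.proj (𝕜 := ℝ) i).continuous.tendsto _).comp hx
  set ℓ := - ∫ x, u x * fderiv ℝ φ x (EuclideanSpace.single i 1) with hℓ
  have hT2 : Tendsto (fun n => ∫ x, gradient (mollify (shrinkingBump N n) u) x i * φ x) atTop
      (𝓝 ℓ) := by
    simp_rw [integral_gradient_mul (hv _) hφ hφc i]
    refine (tendsto_integral_mollify_mul hu ?_ ?_).neg
    · have := hφ.continuous_fderiv (by simp)
      fun_prop
    · exact (hφc.fderiv ℝ).comp_left (g := fun L : EuclideanSpace ℝ (Fin N) →L[ℝ] ℝ =>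
        L (EuclideanSpace.single i 1)) rfl
  -- Integrability together with a pairing in a fixed ball around `ℓ` is a convex condition. It
  -- holds for the late gradients, hence for convex combinations of them.
  have hT3 : Tendsto (fun n => ∫ x, h n x i * φ x) atTop (𝓝 ℓ) := by
    rw [Metric.tendsto_atTop'] at hT2 ⊢
    intro ε hε
    obtain ⟨n₀, hn₀⟩ := hT2 (ε / 2) (half_pos hε)
    refine ⟨n₀, fun n hn => ?_⟩
    have hsub : convexHull ℝ ((fun n => gradient (mollify (shrinkingBump N n) u)) '' Ici n) ⊆
        {f | Integrable (fun x => f x i * φ x) ∧ ∫ x, f x i * φ x ∈ closedBall ℓ (ε / 2)} := by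
      refine convexHull_min ?_ ?_
      · rintro _ ⟨m, hm, rfl⟩
        refine ⟨integrable_mul_of_eLpNorm_lt_top hp.le
          (hmi _ (continuous_gradient (hv m)).measurable)
          ((hcomp _).trans (hK m) |>.trans_lt ENNReal.coe_lt_top) hφi hB', ?_⟩
        exact (hn₀ m (lt_of_lt_of_le hn hm)).le
      · rintro f₁ ⟨h1, h1'⟩ f₂ ⟨h2, h2'⟩ a b ha hb hab
        have e : ∀ x, (a • f₁ + b • f₂) x i * φ x = a * (f₁ x i * φ x) + b * (f₂ x i * φ x) := by
          intro x
          simp only [Pi.add_apply, Pi.smul_apply, PiLp.add_apply, PiLp.smul_apply, smul_eq_mul]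
          ring
        simp only [mem_ofPred_eq, e]
        refine ⟨(h1.const_mul a).add (h2.const_mul b), ?_⟩
        rw [integral_add (h1.const_mul a) (h2.const_mul b), integral_const_mul, integral_const_mul]
        exact convex_closedBall ℓ (ε / 2) h1' h2' ha hb hab
    exact lt_of_le_of_lt (hsub (hmem n)).2 (half_lt_self hε)
  have := tendsto_nhds_unique hT1 hT3
  rw [this, hℓ, neg_neg]

end WeakGradient

/-! ### Passage to the limit in the weak `L^p` quasi-norm -/

/-- If `t < |G z|`, then `t < |F n z|` for all large `n`. So the level set of `G` is, up to a null
set, in the increasing union of the tail intersections, and continuity from below applies. -/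
theorem weakLpNorm_le_of_ae_tendsto {α : Type*} [MeasurableSpace α] {μ : Measure α} {p : ℝ}
    (hp : 0 < p) {F : ℕ → α → ℝ} {G : α → ℝ} {B : ℝ≥0∞} (hF : ∀ n, weakLpNorm (F n) p μ ≤ B)
    (hlim : ∀ᵐ z ∂μ, Tendsto (fun n => F n z) atTop (𝓝 (G z))) : weakLpNorm G p μ ≤ B := by
  refine weakLpNorm_le_of_forall hp fun t ht => ?_
  have h1 : μ {z | t < |G z|} ≤ μ (⋃ n, ⋂ m ≥ n, {z | t < |F m z|}) := by
    refine measure_mono_ae ?_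
    filter_upwards [hlim] with z hz hzt
    obtain ⟨n, hn⟩ := eventually_atTop.1 (hz.abs.eventually_const_lt hzt)
    exact mem_iUnion.2 ⟨n, mem_iInter₂.2 hn⟩
  have hmono : Monotone fun n => ⋂ m ≥ n, {z | t < |F m z|} := fun n n' hnn' =>
    biInter_mono (fun m (hm : n' ≤ m) => hnn'.trans hm) fun _ _ => Subset.rfl
  refine (mul_le_mul' le_rfl h1).trans ?_
  rw [hmono.measure_iUnion, ENNReal.mul_iSup]
  refine iSup_le fun n => ?_
  calc ENNReal.ofReal t ^ p * μ (⋂ m ≥ n, {z | t < |F m z|})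
      ≤ ENNReal.ofReal t ^ p * μ {z | t < |F n z|} := by
        gcongr; exact biInter_subset_of_mem (le_refl n)
    _ ≤ weakLpNorm (F n) p μ ^ p := ofReal_rpow_mul_le_weakLpNorm_rpow _ hp ht
    _ ≤ B ^ p := ENNReal.rpow_le_rpow (hF n) hp.le

theorem ae_nuMeasure_of_ae {N : ℕ} {γ : ℝ} {P : EuclideanSpace ℝ (Fin N) → Prop}
    (h : ∀ᵐ x, P x) : ∀ᵐ z ∂(nuMeasure N γ), P z.1 ∧ P z.2 := by
  have hac : nuMeasure N γ ≪ (volume : Measure (EuclideanSpace ℝ (Fin N))).prod volume :=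
    (withDensity_absolutelyContinuous _ _).trans Measure.absolutelyContinuous_restrict
  refine hac.ae_le ?_
  filter_upwards [Measure.quasiMeasurePreserving_fst.ae h, Measure.quasiMeasurePreserving_snd.ae h]
    with z h1 h2 using ⟨h1, h2⟩

theorem ae_tendsto_diffQuot_mollify {N : ℕ} (γ b : ℝ) {u : EuclideanSpace ℝ (Fin N) → ℝ}
    (hu : LocallyIntegrable u) : ∀ᵐ z ∂(nuMeasure N γ),
      Tendsto (fun n => diffQuot b (mollify (shrinkingBump N n) u) z) atTop
        (𝓝 (diffQuot b u z)) := by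
  filter_upwards [ae_nuMeasure_of_ae (ae_tendsto_mollify hu)] with z hz
  exact (hz.1.sub hz.2).div_const _

theorem weakLpNorm_diffQuot_congr_ae {N : ℕ} {p γ b : ℝ} {u v : EuclideanSpace ℝ (Fin N) → ℝ}
    (h : u =ᵐ[volume] v) : weakLpNorm (diffQuot b u) p (nuMeasure N γ) =
      weakLpNorm (diffQuot b v) p (nuMeasure N γ) := by
  refine weakLpNorm_congr_ae ?_
  filter_upwards [ae_nuMeasure_of_ae h] with z hz
  rw [diffQuot, diffQuot, hz.1, hz.2]

/-! ### The main theorem -/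

theorem exists_weakLpNorm_diffQuot_le_of_hasWeakGradient (N : ℕ) {p γ : ℝ} (hp : 1 < p)
    (hγ : γ ≠ 0) : ∃ C : ℝ≥0, ∀ u : EuclideanSpace ℝ (Fin N) → ℝ, LocallyIntegrable u →
      ∀ g : EuclideanSpace ℝ (Fin N) → EuclideanSpace ℝ (Fin N), HasWeakGradient u g →
        weakLpNorm (diffQuot (γ / p) u) p (nuMeasure N γ)
          ≤ (C : ℝ≥0∞) * eLpNorm g (ENNReal.ofReal p) volume := by
  obtain ⟨C, hC⟩ := exists_weakLpNorm_diffQuot_le N hp hγ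
  refine ⟨C, fun u hu g hg => ?_⟩
  refine weakLpNorm_le_of_ae_tendsto (by linarith) (fun n => ?_)
    (ae_tendsto_diffQuot_mollify γ (γ / p) hu)
  refine (hC _ (contDiff_mollify (n := 1) _ hu)).trans ?_
  rw [← eLpNorm_gradient_eq, gradient_mollify _ hu hg]
  gcongr
  exact eLpNorm_mollify_le _ hg.1.aestronglyMeasurable hp.le

theorem exists_eLpNorm_gradient_mollify_le (N : ℕ) {p : ℝ} (hp : 1 < p) (γ : ℝ) :
    ∃ C : ℝ≥0, ∀ u : EuclideanSpace ℝ (Fin N) → ℝ, LocallyIntegrable u →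
      ∀ φ : ContDiffBump (0 : EuclideanSpace ℝ (Fin N)),
        eLpNorm (gradient (mollify φ u)) (ENNReal.ofReal p) volume ≤
          C * weakLpNorm (diffQuot (γ / p) u) p (nuMeasure N γ) := by
  have hp0 : 0 < p := by linarith
  obtain ⟨C, hC⟩ := exists_weakLpNorm_diffQuot_mollify_le N hp γ (γ / p)
  obtain ⟨κ, hκ0, -, hκ⟩ := exists_lintegral_fderiv_le_weakLpNorm N hp0 γ
  -- For `γ = 0` the constant `κ` is infinite and cannot be cancelled; capping it at `1` gives a
  -- finite positive constant in all cases.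
  have hm0 : min κ 1 ≠ 0 := (lt_min (pos_iff_ne_zero.2 hκ0) one_pos).ne'
  have hmt : min κ 1 ≠ ⊤ := ne_top_of_le_ne_top ENNReal.one_ne_top (min_le_right _ _)
  have hct : ((min κ 1)⁻¹) ^ (1 / p) ≠ ⊤ :=
    ENNReal.rpow_ne_top_of_nonneg (by positivity) (ENNReal.inv_ne_top.2 hm0)
  refine ⟨(((min κ 1)⁻¹) ^ (1 / p)).toNNReal * C, fun u hu φ => ?_⟩
  rw [ENNReal.coe_mul, ENNReal.coe_toNNReal hct]
  -- The mollification bound needs a measurable function; passing to a representative alters neither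
  -- the quasi-norm nor the mollification.
  have hae := hu.aestronglyMeasurable.ae_eq_mk
  have hu' : LocallyIntegrable (hu.aestronglyMeasurable.mk u) := hu.congr hae
  have h1 := hC _ hu.aestronglyMeasurable.stronglyMeasurable_mk.measurable hu' φ
  rw [← weakLpNorm_diffQuot_congr_ae hae, ← mollify_congr_ae φ hae] at h1
  have h2 := hκ _ (contDiff_mollify (n := 1) φ hu)
  rw [eLpNorm_gradient_eq, ← ENNReal.rpow_le_rpow_iff hp0, eLpNorm_ofReal_rpow_eq _ hp0, mul_assoc,
    ENNReal.mul_rpow_of_nonneg _ _ hp0.le, ← ENNReal.rpow_mul, one_div_mul_cancel hp0.ne',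
    ENNReal.rpow_one]
  calc ∫⁻ x, ‖fderiv ℝ (mollify φ u) x‖ₑ ^ p
      = (min κ 1)⁻¹ * (min κ 1 * ∫⁻ x, ‖fderiv ℝ (mollify φ u) x‖ₑ ^ p) := by
        rw [← mul_assoc, ENNReal.inv_mul_cancel hm0 hmt, one_mul]
    _ ≤ (min κ 1)⁻¹ * (κ * ∫⁻ x, ‖fderiv ℝ (mollify φ u) x‖ₑ ^ p) := by
        gcongr; exact min_le_left _ _
    _ ≤ _ := by
        gcongr
        exact h2.trans (ENNReal.rpow_le_rpow h1 hp0.le)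

/-- For `γ = 0` the quasi-norm of the difference quotient of a bump function is infinite. -/
theorem not_exists_weakLpNorm_diffQuot_le_zero {N : ℕ} (hN : 1 ≤ N) {p : ℝ} (hp : 1 < p) :
    ¬ ∃ C : ℝ≥0, ∀ u : EuclideanSpace ℝ (Fin N) → ℝ, ContDiff ℝ ∞ u → HasCompactSupport u →
      weakLpNorm (diffQuot (0 / p) u) p (nuMeasure N 0) ≤
        (C : ℝ≥0∞) * eLpNorm (gradient u) (ENNReal.ofReal p) volume := by
  rintro ⟨C, hC⟩
  have hp0 : 0 < p := by linarith
  obtain ⟨κ, -, hκt, hκ⟩ := exists_lintegral_fderiv_le_weakLpNorm N hp0 0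
  set φ := shrinkingBump N 0
  have hφ : ContDiff ℝ ∞ φ := φ.contDiff
  have hφ1 : ContDiff ℝ 1 φ := φ.contDiff
  have hcont : Continuous (fderiv ℝ φ) := hφ1.continuous_fderiv one_ne_zero
  have h1 := hC φ hφ φ.hasCompactSupport
  rw [eLpNorm_gradient_eq] at h1
  have h2 := hκ φ hφ1
  rw [hκt rfl] at h2
  have hfin : eLpNorm (fderiv ℝ φ) (ENNReal.ofReal p) volume < ⊤ :=
    (hcont.memLp_of_hasCompactSupport (φ.hasCompactSupport.fderiv ℝ)).2
  have h3 : ⊤ * ∫⁻ x, ‖fderiv ℝ φ x‖ₑ ^ p < ⊤ := by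
    refine lt_of_le_of_lt h2 (ENNReal.rpow_lt_top_of_nonneg hp0.le ?_)
    exact ne_top_of_le_ne_top (ENNReal.mul_ne_top ENNReal.coe_ne_top hfin.ne) h1
  have h4 : ∫⁻ x, ‖fderiv ℝ φ x‖ₑ ^ p = 0 := by
    by_contra h
    rw [ENNReal.top_mul h] at h3
    exact lt_irrefl _ h3
  rw [lintegral_eq_zero_iff ((measurable_fderiv ℝ φ).enorm.pow_const p)] at h4
  have h5 : fderiv ℝ φ =ᵐ[volume] fun _ => 0 := by
    filter_upwards [h4] with x hx
    rw [Pi.zero_apply, ENNReal.rpow_eq_zero_iff_of_pos hp0, ← ofReal_norm,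
      ENNReal.ofReal_eq_zero] at hx
    exact norm_le_zero_iff.1 hx
  have h6 : fderiv ℝ φ = fun _ => 0 := (hcont.ae_eq_iff_eq volume continuous_const).1 h5
  -- The bump is `1` at the origin and `0` at distance `3`, beyond its outer radius `2`; `N ≥ 1`
  -- provides a coordinate direction to move in.
  have h7 := is_const_of_fderiv_eq_zero (hφ1.differentiable one_ne_zero)
    (fun x => congrFun h6 x) 0 (EuclideanSpace.single ⟨0, hN⟩ 3)
  rw [φ.one_of_mem_closedBall (mem_closedBall_self φ.rIn_pos.le), φ.zero_of_le_dist] at h7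
  · exact one_ne_zero h7
  · rw [dist_zero_right, PiLp.norm_single]
    change 2 * (1 / (((0 : ℕ) : ℝ) + 1)) ≤ ‖(3 : ℝ)‖
    norm_num

end

end SobolevDifferenceQuotients

theorem theorem1p3 (N : ℕ) (hN : 1 ≤ N) (p : ℝ) (hp : 1 < p) (γ : ℝ) :
    -- the weak-type bound on `C_c^∞` holds if and only if `γ ≠ 0`
    ((∃ C : ℝ≥0, ∀ u : EuclideanSpace ℝ (Fin N) → ℝ, ContDiff ℝ ∞ u → HasCompactSupport u →
        weakLpNorm (diffQuot (γ / p) u) p (nuMeasure N γ)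
          ≤ (C : ℝ≥0∞) * eLpNorm (gradient u) (ENNReal.ofReal p) volume) ↔ γ ≠ 0) ∧
    -- in this case it extends to the homogeneous Sobolev space
    (γ ≠ 0 → ∃ C : ℝ≥0, ∀ u : EuclideanSpace ℝ (Fin N) → ℝ, MemHomogeneousSobolev p u →
      ∀ g : EuclideanSpace ℝ (Fin N) → EuclideanSpace ℝ (Fin N), HasWeakGradient u g →
        weakLpNorm (diffQuot (γ / p) u) p (nuMeasure N γ)
          ≤ (C : ℝ≥0∞) * eLpNorm g (ENNReal.ofReal p) volume) ∧
    -- the converse, for every real `γ`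
    (∃ C : ℝ≥0, ∀ u : EuclideanSpace ℝ (Fin N) → ℝ, LocallyIntegrable u volume →
      weakLpNorm (diffQuot (γ / p) u) p (nuMeasure N γ) < ⊤ →
        MemHomogeneousSobolev p u ∧
        ∀ g : EuclideanSpace ℝ (Fin N) → EuclideanSpace ℝ (Fin N), HasWeakGradient u g →
          eLpNorm g (ENNReal.ofReal p) volume
            ≤ (C : ℝ≥0∞) * weakLpNorm (diffQuot (γ / p) u) p (nuMeasure N γ)) := by
  refine ⟨⟨?_, fun hγ => ?_⟩, fun hγ => ?_, ?_⟩
  · rintro h rfl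
    exact not_exists_weakLpNorm_diffQuot_le_zero hN hp h
  · obtain ⟨C, hC⟩ := exists_weakLpNorm_diffQuot_le N hp hγ
    refine ⟨C, fun u hu _ => ?_⟩
    rw [eLpNorm_gradient_eq]
    exact hC u (hu.of_le (by simp))
  · obtain ⟨C, hC⟩ := exists_weakLpNorm_diffQuot_le_of_hasWeakGradient N hp hγ
    exact ⟨C, fun u hu g hg => hC u hu.1 g hg⟩
  · obtain ⟨C, hC⟩ := exists_eLpNorm_gradient_mollify_le N hp γ
    refine ⟨C, fun u hu hW => ⟨?_, fun g hg => ?_⟩⟩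
    · have ht : (C : ℝ≥0∞) * weakLpNorm (diffQuot (γ / p) u) p (nuMeasure N γ) ≠ ⊤ :=
        ENNReal.mul_ne_top ENNReal.coe_ne_top hW.ne
      refine memHomogeneousSobolev_of_eLpNorm_gradient_mollify_le hp hu
        (K := ((C : ℝ≥0∞) * weakLpNorm (diffQuot (γ / p) u) p (nuMeasure N γ)).toNNReal)
        fun n => ?_
      rw [ENNReal.coe_toNNReal ht]
      exact hC u hu _
    -- An arbitrary weak gradient `g` is the almost everywhere limit of its mollifications, which
    -- are the gradients already bounded; Fatou's lemma transfers the bound.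
    · refine (Lp.eLpNorm_lim_le_liminf_eLpNorm
        (fun n => (contDiff_mollify (n := 0) _ hg.1).continuous.aestronglyMeasurable) g
        (ae_tendsto_mollify hg.1)).trans ?_
      refine Filter.liminf_le_of_frequently_le' (Filter.Frequently.of_forall fun n => ?_)
      rw [← gradient_mollify _ hu hg]
      exact hC u hu _
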